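/- **Proposition 8.** Let $d\ge 1$ be an integer and $0<\alpha<1$. Consider the following recursive splitting of unity. Let $D_w=(X_{w,1},\dots,X_{w,d+1},Y_w)$, indexed by all finite words $w$ over the alphabet $\{1,\dots,d+1\}$, be independent random vectors, each with the Dirichlet distribution with parameters $(\alpha/d,\dots,\alpha/d,1-\alpha)$, where $\alpha/d$ occurs $d+1$ times. Start with a unit crumb $\xi_\emptyset=1$; the crumb $\xi_w$ splits into $d+1$ crumbs $\xi_{wi}=\xi_wX_{w,i}$ $(1\le i\le d+1)$ and one solid $\eta_w=\xi_wY_w$; crumbs split further and solids do not. Then almost surely $\eta_w\ge 0$ for all $w$ and $\sum_w\eta_w=1$. Paint balls $1,2,\dots$ so that, conditionally given $(\eta_w)_w$, the balls are painted independently, each receiving color $w$ with probability $\eta_w$, and let $\mathcal P$ be the random exchangeable partition of $\{1,2,\dots\}$ into classes of balls of the same color. Then $\mathcal P$ coincides in law with the Ewens–Pitman partition with parameters $(\alpha,\theta)$, $\theta=\alpha/d$. That is: 1. $\mathcal P$ has the same law as the partition obtained by painting balls in the same way from the Poisson–Dirichlet $(\alpha,\theta)$ paintbox $P_j=W_1\cdots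 W_{j-1}(1-W_j)$, $j=1,2,\dots$, where the $W_j$ are independent and $W_j$ has the $\mathrm{beta}(\theta+j\alpha,1-\alpha)$ distribution; 2. if $K_{nr}$ is the number of blocks of size $r$ in the restriction of $\mathcal P$ to the first $n$ balls, then for all $n$ and all nonnegative integers $k_1,\dots,k_n$ with $\sum_r rk_r=n$, writing $\ell=k_1+\dots+k_n$ and $(a)_{i\uparrow}=a(a+1)\cdots(a+i-1)$, $$\mathbb P[K_{n1}=k_1,\dots,K_{nn}=k_n]=n!\,\frac{\theta(\theta+\alpha)\cdots(\theta+(\ell-1)\alpha)}{(\theta)_{n\uparrow}}\prod_{i=1}^n\frac{\big((1-\alpha)_{(i-1)\uparrow}\big)^{k_i}}{(i!)^{k_i}\,k_i!}.$$ -/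

import Mathlib

open MeasureTheory ProbabilityTheory

/-- The Dirichlet distribution with parameters `a i > 0`: the law of `(g i / ∑ j, g j)_i`, where the
`g i` are independent and `g i` has the gamma distribution with shape `a i` and rate `1`. -/
noncomputable def dirichletMeasure {ι : Type*} [Fintype ι] (a : ι → ℝ) : Measure (ι → ℝ) :=
  (Measure.pi fun i => gammaMeasure (a i) 1).map fun g i => g i / ∑ j, g j

/-- The size of the crumb labelled by a word, in a splitting scheme where every crumb splits into
crumbs indexed by `ι` and one solid. `D w (some i)` and `D w none` are the sizes, relative to the
crumb `w`, of its `i`-th crumb child and of its solid child. The unit crumb has the empty label, and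
the `i`-th crumb child of `w` has the label `i :: w` (the latest generation stands first). -/
def crumbSize {ι : Type*} (D : List ι → Option ι → ℝ) : List ι → ℝ
  | [] => 1
  | i :: w => crumbSize D w * D w (some i)

/-- The size of the only solid child of the crumb `w`. The paintbox of the splitting scheme is the
family of these sizes, indexed by all words. -/
def solidSize {ι : Type*} (D : List ι → Option ι → ℝ) (w : List ι) : ℝ :=
  crumbSize D w * D w none

/-- The parameters `(α/d, …, α/d, 1 - α)`: `α/d` for each of the `d + 1` crumbs, `1 - α` for the
solid. -/
noncomputable def splittingParam (d : ℕ) (α : ℝ) : Option (Fin (d + 1)) → ℝ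
  | some _ => α / d
  | none => 1 - α

/-- `C n` is the color of ball `n`: conditionally given the random frequencies `P`, the balls are
painted independently, and each gets the color `j` with probability `P j`. -/
def IsPaintboxSample {Ω J : Type*} [MeasurableSpace Ω] (μ : Measure Ω) (P : J → Ω → ℝ)
    (C : ℕ → Ω → J) : Prop :=
  (∀ n j, MeasurableSet {ω | C n ω = j}) ∧
  ∀ (n : ℕ) (c : Fin n → J) (A : Set (J → ℝ)), MeasurableSet A →
    μ {ω | (fun j => P j ω) ∈ A ∧ ∀ k : Fin n, C k ω = c k} =
      ∫⁻ ω in {ω | (fun j => P j ω) ∈ A}, ∏ k : Fin n, ENNReal.ofReal (P (c k) ω) ∂μ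

/-- Partitions of the set of balls `ℕ` are equivalence relations, with the `σ`-algebra generated by
the events that balls `m` and `n` are in the same block. -/
instance instMeasurableSpaceSetoidNat : MeasurableSpace (Setoid ℕ) :=
  MeasurableSpace.comap (fun s m n => s.r m n) (inferInstance : MeasurableSpace (ℕ → ℕ → Prop))

/-- The partition of the balls into classes of equal color. -/
def colorPartition {Ω J : Type*} (C : ℕ → Ω → J) (ω : Ω) : Setoid ℕ :=
  Setoid.ker fun n => C n ω

/-- The number of blocks of size `r` in the restriction of a partition to the first `n` balls. -/
noncomputable def blockCount (s : Setoid ℕ) (n r : ℕ) : ℕ :=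
  Set.ncard {B : Set (Fin n) | B ∈ (s.comap (Fin.val : Fin n → ℕ)).classes ∧ B.ncard = r}

/-- `P` is a two-parameter Poisson–Dirichlet paintbox, arranged by stick-breaking:
`P j = W 0 ⋯ W (j-1) (1 - W j)` with independent `W j` of law beta`(θ + (j+1) α, 1 - α)`
(indices start from `0`). -/
def IsPoissonDirichletPaintbox {Ω : Type*} [MeasurableSpace Ω] (μ : Measure Ω) (α θ : ℝ)
    (P : ℕ → Ω → ℝ) : Prop :=
  ∃ W : ℕ → Ω → ℝ, (∀ j, Measurable (W j)) ∧ iIndepFun W μ ∧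
    (∀ j : ℕ, μ.map (W j) = betaMeasure (θ + (j + 1) * α) (1 - α)) ∧
    ∀ j ω, P j ω = (∏ i ∈ Finset.range j, W i ω) * (1 - W j ω)

/-- The Ewens–Pitman probability that a partition of `n` balls has `k r` blocks of size `r` for
each `r = 1, …, n`. -/
noncomputable def ewensPitmanProb (α θ : ℝ) (n : ℕ) (k : ℕ → ℕ) : ℝ :=
  n.factorial *
    ((∏ i ∈ Finset.range (∑ r ∈ Finset.Icc 1 n, k r), (θ + i * α)) /
      (ascPochhammer ℝ n).eval θ) *
    ∏ r ∈ Finset.Icc 1 n, ((ascPochhammer ℝ (r - 1)).eval (1 - α)) ^ k r /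
      ((r.factorial : ℝ) ^ k r * (k r).factorial)

/-!
For a paintbox with frequencies `x`, the probability that given blocks of balls are the color
classes is the sum of `∏ b, x (c b) ^ m b` over all injective assignments `c` of colors to blocks.
Sorting the blocks by the child of the crumb `v` in which their color lies gives a recursion along
the tree of crumbs, whose coefficients are mixed moments of the Dirichlet law. If the parameters
satisfy `∑ i, τ (i :: v) = τ v + α`, then the Ewens–Pitman probabilities with parameters `(α, τ v)`
solve the same recursion: at most one block can reach the solid of `v`, and the contributions of
none and of exactly one such block add up to the Ewens–Pitman probability at `v`.

The two solutions agree, by induction on the number of blocks: in the recursion for their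
difference only the terms survive in which all blocks stay together in one crumb. The total weight
of these terms is at most `(τ v + α) / (τ v + 1)`, and since `τ` grows at most linearly with the
generation, the product of these factors along the tree tends to `0` as the harmonic series
diverges. One block of size `1` gives the total mass of the paintbox.

Stick-breaking is the same scheme with a single crumb per node and `τ = θ + j α` in generation `j`,
so it gives the same partition probabilities. The sampling formula follows by counting the
partitions with prescribed block counts.
-/

open scoped ENNReal

section PaintboxEPPF

theorem ennreal_tsum_prod_pi_fin {n : ℕ} {A : Fin n → Type*} (F : ∀ k, A k → ℝ≥0∞) :
    ∑' c : (∀ k, A k), ∏ k, F k (c k) = ∏ k, ∑' a, F k a := by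
  induction n with
  | zero => simp
  | succ n ih =>
    rw [← (Fin.consEquiv A).tsum_eq, Fin.prod_univ_succ, ← ih, ENNReal.tsum_prod',
      ← ENNReal.tsum_mul_right]
    refine tsum_congr fun a => ?_
    rw [← ENNReal.tsum_mul_left]
    refine tsum_congr fun c => ?_
    simp [Fin.prod_univ_succ, Fin.consEquiv]

theorem ennreal_tsum_prod_pi {K : Type*} [Fintype K] {A : K → Type*} (F : ∀ k, A k → ℝ≥0∞) :
    ∑' c : (∀ k, A k), ∏ k, F k (c k) = ∏ k, ∑' a, F k a := by
  let e := (Fintype.equivFin K).symm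
  rw [← (Equiv.piCongrLeft A e).tsum_eq, ← e.prod_comp, ← ennreal_tsum_prod_pi_fin]
  refine tsum_congr fun c => ?_
  rw [← e.prod_comp]
  simp

/-- An embedding into `K × J` is a map to `K` together with embeddings of its fibers into `J`. -/
def embeddingProdEquiv (B J K : Type*) :
    (B ↪ K × J) ≃ Σ f : B → K, ∀ k, {b // f b = k} ↪ J where
  toFun c := ⟨fun b => (c b).1, fun k => ⟨fun b => (c b).2, fun b b' h => Subtype.ext
    (c.injective (Prod.ext (b.2.trans b'.2.symm) h))⟩⟩
  invFun p := (Equiv.sigmaFiberEquiv p.1).symm.toEmbedding.trans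
    ((Function.Embedding.sigmaMap (.refl K) p.2).trans (Equiv.sigmaEquivProd K J).toEmbedding)
  left_inv c := by ext b <;> rfl
  right_inv p := by
    obtain ⟨f, g⟩ := p
    refine Sigma.ext rfl (heq_of_eq ?_)
    funext k
    ext ⟨b, rfl⟩
    rfl

variable {B J K : Type*} [Fintype B]

/-- The exchangeable partition probability function (EPPF) of the paintbox with frequencies `x`: the
probability that the balls of each block indexed by `B` get one common color and distinct blocks get
distinct colors, as a function of the sizes `m` of the blocks. -/
noncomputable def paintboxEPPF (x : J → ℝ≥0∞) (m : B → ℕ) : ℝ≥0∞ :=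
  ∑' c : B ↪ J, ∏ b, x (c b) ^ m b

theorem paintboxEPPF_prod [Fintype K] [DecidableEq K] [DecidableEq B] (x : K → J → ℝ≥0∞)
    (m : B → ℕ) :
    paintboxEPPF (fun p : K × J => x p.1 p.2) m =
      ∑ f : B → K, ∏ k, paintboxEPPF (x k) (fun b : {b // f b = k} => m b) := by
  unfold paintboxEPPF
  rw [← (embeddingProdEquiv B J K).symm.tsum_eq, ENNReal.tsum_sigma', tsum_fintype]
  refine Finset.sum_congr rfl fun f _ => ?_
  rw [← ennreal_tsum_prod_pi]
  refine tsum_congr fun g => ?_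
  rw [← Fintype.prod_fiberwise f]
  refine Finset.prod_congr rfl fun k _ => Finset.prod_congr rfl ?_
  rintro ⟨b, rfl⟩ _
  rfl

theorem paintboxEPPF_comp_of_support {J' : Type*} (e : J' ↪ J) (x : J → ℝ≥0∞) (m : B → ℕ)
    (hm : ∀ b, m b ≠ 0) (hx : ∀ j, x j ≠ 0 → j ∈ Set.range e) :
    paintboxEPPF (fun j => x (e j)) m = paintboxEPPF x m := by
  unfold paintboxEPPF
  have trans_injective : Function.Injective fun c : B ↪ J' => c.trans e := fun c c' h => by
    ext b
    exact e.injective (by simpa using DFunLike.congr_fun h b)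
  refine trans_injective.tsum_eq (f := fun c : B ↪ J => ∏ b, x (c b) ^ m b) ?_
  intro c hc
  have hc_range : ∀ b, ∃ j, e j = c b := fun b => hx _ fun h0 =>
    hc (Finset.prod_eq_zero (Finset.mem_univ b) (by simp [h0, hm b]))
  choose g hg using hc_range
  refine ⟨⟨g, fun b b' h => c.injective (by rw [← hg, ← hg, h])⟩, ?_⟩
  ext b
  exact hg b

theorem paintboxEPPF_comp_equiv {B' : Type*} [Fintype B'] (e : B' ≃ B) (x : J → ℝ≥0∞)
    (m : B → ℕ) : paintboxEPPF x (fun b => m (e b)) = paintboxEPPF x m := by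
  unfold paintboxEPPF
  rw [← (Equiv.embeddingCongr e (Equiv.refl J)).tsum_eq]
  refine tsum_congr fun c => ?_
  rw [← e.prod_comp]
  simp

theorem paintboxEPPF_of_isEmpty [IsEmpty B] (x : J → ℝ≥0∞) (m : B → ℕ) :
    paintboxEPPF x m = 1 := by
  simp [paintboxEPPF, tsum_fintype]

theorem paintboxEPPF_of_unique [Unique B] (x : J → ℝ≥0∞) (m : B → ℕ) :
    paintboxEPPF x m = ∑' j, x j ^ m default := by
  unfold paintboxEPPF
  rw [← Equiv.uniqueEmbeddingEquivResult.symm.tsum_eq]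
  simp only [Fintype.prod_unique]
  rfl

theorem paintboxEPPF_single [DecidableEq J] (j₀ : J) (y : ℝ≥0∞) (m : B → ℕ)
    (hm : ∀ b, m b ≠ 0) :
    paintboxEPPF (Pi.single j₀ y) m = if Nat.card B ≤ 1 then y ^ ∑ b, m b else 0 := by
  have single_support : ∀ j, (Pi.single j₀ y : J → ℝ≥0∞) j ≠ 0 → j = j₀ := fun j hj => by
    by_contra h
    exact hj (by simp [h])
  rw [← paintboxEPPF_comp_of_support (J' := Unit)
    ⟨fun _ => j₀, Function.injective_of_subsingleton _⟩ _ m hm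
    fun j hj => ⟨(), (single_support j hj).symm⟩]
  split_ifs with h
  · have := Finite.card_le_one_iff_subsingleton.1 h
    have : Unique (B ↪ Unit) :=
      { default := ⟨fun _ => (), Function.injective_of_subsingleton _⟩, uniq := fun _ => by ext }
    simp [paintboxEPPF, tsum_fintype, Finset.prod_pow_eq_pow_sum]
  · have : IsEmpty (B ↪ Unit) := ⟨fun c => h (by
      simpa [Nat.card_eq_fintype_card] using Fintype.card_le_of_embedding c)⟩
    simp [paintboxEPPF]

theorem paintboxEPPF_const_mul (a : ℝ≥0∞) (x : J → ℝ≥0∞) (m : B → ℕ) :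
    paintboxEPPF (fun j => a * x j) m = a ^ (∑ b, m b) * paintboxEPPF x m := by
  simp only [paintboxEPPF, mul_pow, Finset.prod_mul_distrib, Finset.prod_pow_eq_pow_sum,
    ENNReal.tsum_mul_left]

theorem paintboxEPPF_le_one (x : J → ℝ≥0∞) (m : B → ℕ) (hm : ∀ b, m b ≠ 0)
    (hx : ∑' j, x j ≤ 1) : paintboxEPPF x m ≤ 1 :=
  calc paintboxEPPF x m ≤ ∑' c : B → J, ∏ b, x (c b) ^ m b :=
        ENNReal.tsum_comp_le_tsum_of_injective (f := fun c : B ↪ J => (c : B → J))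
          DFunLike.coe_injective (fun c : B → J => ∏ b, x (c b) ^ m b)
    _ = ∏ b, ∑' j, x j ^ m b := ennreal_tsum_prod_pi fun b j => x j ^ m b
    _ ≤ ∏ _b : B, 1 := Finset.prod_le_prod' fun _ _ =>
        (ENNReal.tsum_le_tsum fun j =>
          pow_le_of_le_one zero_le ((ENNReal.le_tsum j).trans hx) (hm _)).trans hx
    _ = 1 := Finset.prod_const_one

end PaintboxEPPF

section AscPochhammer

theorem ascPochhammer_eval_eq_prod_range {S : Type*} [CommSemiring S] (n : ℕ) (x : S) :
    (ascPochhammer S n).eval x = ∏ i ∈ Finset.range n, (x + i) := by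
  induction n with
  | zero => simp
  | succ n ih => rw [ascPochhammer_succ_eval, ih, Finset.prod_range_succ]

theorem ascPochhammer_eval_add_one_mul {S : Type*} [CommSemiring S] (n : ℕ) (x : S) :
    (ascPochhammer S n).eval (x + 1) * x = (ascPochhammer S n).eval x * (x + n) := by
  rw [← ascPochhammer_succ_eval]
  simp [ascPochhammer_succ_left, Polynomial.eval_comp, mul_comm]

theorem ascPochhammer_eval_one_sub_of_ne_zero {S : Type*} [CommRing S] {n : ℕ} (hn : n ≠ 0)
    (x : S) :
    (ascPochhammer S n).eval (1 - x) = (ascPochhammer S (n - 1)).eval (1 - x) * (n - x) := by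
  obtain ⟨l, rfl⟩ := Nat.exists_eq_succ_of_ne_zero hn
  rw [Nat.succ_eq_add_one, ascPochhammer_succ_eval, Nat.add_sub_cancel]
  push_cast
  ring

theorem prod_range_add_mul_le_ascPochhammer_eval {α θ : ℝ} (hα0 : 0 ≤ α) (hα1 : α ≤ 1)
    (hθ : 0 < θ) {l n : ℕ} (hl : l ≠ 0) (hln : l ≤ n) :
    ∏ i ∈ Finset.range l, (θ + i * α) ≤ (ascPochhammer ℝ n).eval θ := by
  induction n, hln using Nat.le_induction with
  | base =>
    rw [ascPochhammer_eval_eq_prod_range]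
    exact Finset.prod_le_prod (fun i _ => by positivity) fun i _ =>
      add_le_add_right (mul_le_of_le_one_right i.cast_nonneg hα1) θ
  | succ n hn ih =>
    have one_le_factor : 1 ≤ θ + n := by
      have : (1 : ℝ) ≤ n := by exact_mod_cast (Nat.one_le_iff_ne_zero.2 hl).trans hn
      linarith
    rw [ascPochhammer_succ_eval]
    exact ih.trans (le_mul_of_one_le_right (ascPochhammer_pos n θ hθ).le one_le_factor)

end AscPochhammer

section Split

variable {B ι : Type*} [Fintype ι]

/-- The parameters of a splitting: `τ i` for the `i`-th crumb, `1 - α` for the solid. -/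
def splitParam (α : ℝ) (τ : ι → ℝ) : Option ι → ℝ
  | some i => τ i
  | none => 1 - α

/-- The mixed moment `∏ k, (a k)_{r k} / (∑ k, a k)_{∑ k, r k}` of the Dirichlet distribution. -/
noncomputable def dirichletMoment {K : Type*} [Fintype K] (a : K → ℝ) (r : K → ℕ) : ℝ :=
  (∏ k, (ascPochhammer ℝ (r k)).eval (a k)) / (ascPochhammer ℝ (∑ k, r k)).eval (∑ k, a k)

/-- The probability that one splitting with Dirichlet parameters `a` sends the balls of each block
`b`, which has size `m b`, to the child `f b`. It vanishes if two blocks go to the solid `none`,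
because distinct blocks end up in distinct solids. -/
noncomputable def splitProb [Fintype B] [DecidableEq ι] (a : Option ι → ℝ) (m : B → ℕ)
    (f : B → Option ι) : ℝ :=
  if Nat.card {b // f b = none} ≤ 1 then dirichletMoment a (fun k => ∑ b : {b // f b = k}, m b)
  else 0

/-- The Ewens–Pitman exchangeable partition probability function, that is, the probability of a
given partition into blocks indexed by `B`, of sizes `m b`. -/
noncomputable def ewensPitmanEPPF [Fintype B] (α θ : ℝ) (m : B → ℕ) : ℝ :=
  (∏ i ∈ Finset.range (Nat.card B), (θ + i * α)) / (ascPochhammer ℝ (∑ b, m b)).eval θ *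
    ∏ b, (ascPochhammer ℝ (m b - 1)).eval (1 - α)

/-- The weight of an assignment `f` of blocks to crumbs (`some i`) and to the solid (`none`) in the
recursion of the Ewens–Pitman probabilities, after removing the factors which do not depend on
`f`. -/
noncomputable def splitWeight [Fintype B] (α : ℝ) (a : ι → ℝ) (m : B → ℕ) (f : B → Option ι) : ℝ :=
  (∏ b, if f b = none then (m b - α : ℝ) else 1) *
    ∏ i, ∏ j ∈ Finset.range (Nat.card {b // f b = some i}), (a i + j * α)

/-- The total weight of the assignments which send exactly `c` blocks to the solid. -/
noncomputable def splitWeightSum [Fintype B] [DecidableEq B] (α : ℝ) (a : ι → ℝ) (m : B → ℕ)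
    (c : ℕ) : ℝ :=
  ∑ f : B → Option ι, if Nat.card {b // f b = none} = c then splitWeight α a m f else 0

theorem sum_splitParam (α : ℝ) (τ : ι → ℝ) : ∑ k, splitParam α τ k = ∑ i, τ i + 1 - α := by
  rw [Fintype.sum_option]
  simp only [splitParam]
  ring

theorem card_fiber_option [Finite B] {K : Type*} [DecidableEq K] (f : Option B → K) (k : K) :
    Nat.card {b // f b = k} =
      Nat.card {b // f (some b) = k} + if f none = k then 1 else 0 := by
  have := Fintype.ofFinite B
  simp only [Nat.card_eq_fintype_card, Fintype.card_subtype, Finset.card_filter, Fintype.sum_option]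
  rw [add_comm]

theorem card_fiber_comp_equiv {B' K : Type*} (e : B' ≃ B) (f : B → K) (k : K) :
    Nat.card {b // (f ∘ e) b = k} = Nat.card {b // f b = k} :=
  Nat.card_congr (e.subtypeEquiv fun _ => Iff.rfl)

theorem sum_card_fiber_some_add_card_fiber_none [Finite B] (f : B → Option ι) :
    ∑ i, Nat.card {b // f b = some i} + Nat.card {b // f b = none} = Nat.card B := by
  rw [← Nat.card_congr (Equiv.sigmaFiberEquiv f), Nat.card_sigma, Fintype.sum_option, add_comm]

theorem splitWeight_option [Fintype B] (α : ℝ) (a : ι → ℝ) (m : Option B → ℕ)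
    (f : Option B → Option ι) :
    splitWeight α a m f = splitWeight α a (fun b => m (some b)) (fun b => f (some b)) *
      match f none with
      | none => (m none - α : ℝ)
      | some i => a i + Nat.card {b // f (some b) = some i} * α := by
  classical
  unfold splitWeight
  rw [Fintype.prod_option]
  rcases h : f none with _ | i
  · simp only [card_fiber_option, h, reduceCtorEq, ↓reduceIte, add_zero]
    ring
  · have prod_range_card_option : ∀ i',
        (∏ j ∈ Finset.range (Nat.card {b // f b = some i'}), (a i' + j * α)) =
        (∏ j ∈ Finset.range (Nat.card {b // f (some b) = some i'}), (a i' + j * α)) *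
          if i' = i then (a i + Nat.card {b // f (some b) = some i} * α) else 1 := by
      intro i'
      rw [card_fiber_option, h]
      by_cases hi : i' = i
      · subst hi; simp [Finset.prod_range_succ]
      · simp [hi, Ne.symm hi]
    simp only [prod_range_card_option, Finset.prod_mul_distrib, reduceCtorEq, ↓reduceIte,
      Finset.prod_ite_eq', Finset.mem_univ, one_mul, mul_assoc]

theorem splitWeightSum_comp_equiv {B' : Type*} [Fintype B] [Fintype B'] [DecidableEq B]
    [DecidableEq B'] (e : B' ≃ B) (α : ℝ) (a : ι → ℝ) (m : B → ℕ) (c : ℕ) :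
    splitWeightSum α a (m ∘ e) c = splitWeightSum α a m c := by
  unfold splitWeightSum
  rw [← (Equiv.arrowCongr e (Equiv.refl (Option ι))).symm.sum_comp]
  refine Finset.sum_congr rfl fun f _ => ?_
  have card_fiber : ∀ k, Nat.card {b // (Equiv.arrowCongr e (Equiv.refl (Option ι))).symm f b = k} =
    Nat.card {b // f b = k} := fun k => card_fiber_comp_equiv e f k
  simp only [splitWeight, card_fiber]
  congr 2
  rw [← e.prod_comp]
  rfl

theorem splitWeightSum_option [Fintype B] [DecidableEq B] (α : ℝ) (a : ι → ℝ)
    (m : Option B → ℕ) (c : ℕ) :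
    splitWeightSum α a m c =
      splitWeightSum α a (fun b => m (some b)) c * (∑ i, a i + (Nat.card B - c) * α) +
      ∑ f : B → Option ι, (if Nat.card {b // f b = none} + 1 = c then
        splitWeight α a (fun b => m (some b)) f else 0) * (m none - α) := by
  classical
  let e : (Option ι × (B → Option ι)) ≃ (Option B → Option ι) :=
    (Equiv.piOptionEquivProd (β := fun _ : Option B => Option ι)).symm
  unfold splitWeightSum
  rw [← e.sum_comp, Fintype.sum_prod_type_right, Finset.sum_mul, ← Finset.sum_add_distrib]
  refine Finset.sum_congr rfl fun f _ => ?_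
  have e_none : ∀ k, e (k, f) none = k := fun _ => rfl
  have e_some : ∀ k b, e (k, f) (some b) = f b := fun _ _ => rfl
  simp only [splitWeight_option, card_fiber_option, e_none, e_some, Fintype.sum_option,
    if_true, reduceCtorEq, if_false, add_zero, ite_zero_mul]
  rw [add_comm]
  congr 1
  split_ifs with h
  · have sum_card := congrArg (Nat.cast : ℕ → ℝ) (sum_card_fiber_some_add_card_fiber_none f)
    push_cast at sum_card
    rw [← Finset.mul_sum, Finset.sum_add_distrib, ← Finset.sum_mul, ← sum_card, h]
    ring
  · exact Finset.sum_const_zero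

theorem splitWeightSum_zero [Fintype B] [DecidableEq B] (α : ℝ) (a : ι → ℝ) (m : B → ℕ) :
    splitWeightSum α a m 0 = ∏ j ∈ Finset.range (Nat.card B), (∑ i, a i + j * α) := by
  revert m
  refine Fintype.induction_empty_option (P := fun B _ => ∀ [DecidableEq B] (m : B → ℕ),
    splitWeightSum α a m 0 = ∏ j ∈ Finset.range (Nat.card B), (∑ i, a i + j * α)) ?_ ?_ ?_ B
  · intro B B' _ e ih _ m
    let _ := Fintype.ofEquiv B' e.symm
    classical
    rw [← splitWeightSum_comp_equiv e, ← Nat.card_congr e]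
    exact ih (m ∘ e)
  · intro _ m
    simp [splitWeightSum, splitWeight]
  · intro B _ ih inst m
    classical
    obtain rfl : inst = Option.instDecidableEq := Subsingleton.elim _ _
    rw [splitWeightSum_option, ih, Finite.card_option, Finset.prod_range_succ]
    simp

theorem splitWeightSum_one [Fintype B] [DecidableEq B] (α : ℝ) (a : ι → ℝ) (m : B → ℕ) :
    splitWeightSum α a m 1 = (∑ b, (m b : ℝ) - Nat.card B * α) *
      ∏ j ∈ Finset.range (Nat.card B - 1), (∑ i, a i + j * α) := by
  revert m
  refine Fintype.induction_empty_option (P := fun B _ => ∀ [DecidableEq B] (m : B → ℕ),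
    splitWeightSum α a m 1 = (∑ b, (m b : ℝ) - Nat.card B * α) *
      ∏ j ∈ Finset.range (Nat.card B - 1), (∑ i, a i + j * α)) ?_ ?_ ?_ B
  · intro B B' _ e ih _ m
    let _ := Fintype.ofEquiv B' e.symm
    classical
    rw [← splitWeightSum_comp_equiv e, ← Nat.card_congr e, ← e.sum_comp fun b => (m b : ℝ)]
    exact ih (m ∘ e)
  · intro _ m
    simp [splitWeightSum]
  · intro B _ ih inst m
    classical
    obtain rfl : inst = Option.instDecidableEq := Subsingleton.elim _ _
    simp only [splitWeightSum_option, ih, add_eq_right, ← Finset.sum_mul]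
    rw [← splitWeightSum, splitWeightSum_zero, Finite.card_option, Fintype.sum_option,
      Nat.add_sub_cancel]
    rcases h : Nat.card B with _ | l
    · have : IsEmpty B := Finite.card_eq_zero_iff.1 h
      simp
    · rw [Nat.add_sub_cancel, Finset.prod_range_succ]
      push_cast
      ring

end Split

section EwensPitman

variable {B ι : Type*} [Fintype B] [Fintype ι] {α θ : ℝ} {τ : ι → ℝ}

theorem prod_eq_prod_fiber_none_mul_prod_fiber_some [DecidableEq ι] {M : Type*} [CommMonoid M]
    (f : B → Option ι) (g : B → M) :
    ∏ b, g b = (∏ b : {b // f b = none}, g b) * ∏ i, ∏ b : {b // f b = some i}, g b := by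
  rw [← Fintype.prod_fiberwise f, Fintype.prod_option]

theorem ascPochhammer_eval_sum_of_subsingleton [Subsingleton B] (m : B → ℕ) (hm : ∀ b, m b ≠ 0) :
    (ascPochhammer ℝ (∑ b, m b)).eval (1 - α) =
      (∏ b, (ascPochhammer ℝ (m b - 1)).eval (1 - α)) * ∏ b, (m b - α : ℝ) := by
  rcases isEmpty_or_nonempty B with h | ⟨⟨b⟩⟩
  · simp
  · simp only [Fintype.sum_subsingleton _ b, Fintype.prod_subsingleton _ b]
    exact ascPochhammer_eval_one_sub_of_ne_zero (hm b) α

theorem splitProb_mul_prod_ewensPitmanEPPF [DecidableEq ι] (hτ : ∀ i, 0 < τ i) (m : B → ℕ)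
    (hm : ∀ b, m b ≠ 0) (f : B → Option ι) :
    splitProb (splitParam α τ) m f *
      ∏ i, ewensPitmanEPPF α (τ i) (fun b : {b // f b = some i} => m b) =
    (∏ b, (ascPochhammer ℝ (m b - 1)).eval (1 - α)) /
      (ascPochhammer ℝ (∑ b, m b)).eval (∑ i, τ i + 1 - α) *
      if Nat.card {b // f b = none} ≤ 1 then splitWeight α τ m f else 0 := by
  unfold splitProb
  split_ifs with hf
  swap
  · simp
  have := Finite.card_le_one_iff_subsingleton.1 hf
  have prod_solid : (∏ b, if f b = none then (m b - α : ℝ) else 1) =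
      ∏ b : {b // f b = none}, (m b - α : ℝ) := by
    rw [← Finset.prod_filter]
    exact Finset.prod_subtype _ (by simp) _
  have crumbs_ne_zero :
      ∏ i, (ascPochhammer ℝ (∑ b : {b // f b = some i}, m b)).eval (τ i) ≠ 0 :=
    Finset.prod_ne_zero_iff.2 fun i _ => (ascPochhammer_pos _ _ (hτ i)).ne'
  unfold dirichletMoment ewensPitmanEPPF splitWeight
  rw [Fintype.sum_fiberwise f m, sum_splitParam, Fintype.prod_option, prod_solid,
    prod_eq_prod_fiber_none_mul_prod_fiber_some f
      fun b => (ascPochhammer ℝ (m b - 1)).eval (1 - α)]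
  simp only [splitParam, Finset.prod_mul_distrib, Finset.prod_div_distrib,
    ascPochhammer_eval_sum_of_subsingleton (fun b : {b // f b = none} => m b) fun b => hm b]
  field_simp

-- The blocks which reach the solid number `0` or `1`, so the recursion is the sum of
-- `splitWeightSum_zero` and `splitWeightSum_one`.
theorem ewensPitmanEPPF_eq_sum_splitProb [DecidableEq ι] [DecidableEq B] [Nonempty B]
    (hθ : 0 < θ) (hτ : ∀ i, 0 < τ i) (hsum : ∑ i, τ i = θ + α) (m : B → ℕ)
    (hm : ∀ b, m b ≠ 0) :
    ewensPitmanEPPF α θ m = ∑ f : B → Option ι, splitProb (splitParam α τ) m f *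
      ∏ i, ewensPitmanEPPF α (τ i) (fun b : {b // f b = some i} => m b) := by
  have ite_le_one : ∀ f : B → Option ι,
      (if Nat.card {b // f b = none} ≤ 1 then splitWeight α τ m f else 0) =
      (if Nat.card {b // f b = none} = 0 then splitWeight α τ m f else 0) +
        if Nat.card {b // f b = none} = 1 then splitWeight α τ m f else 0 := by
    intro f
    split_ifs <;> first | omega | simp
  obtain ⟨l, hl⟩ := Nat.exists_eq_add_one_of_ne_zero (Nat.card_pos (α := B)).ne'
  have prod_shift : ∏ i ∈ Finset.range (l + 1), (θ + i * α) =
      (∏ j ∈ Finset.range l, (θ + α + j * α)) * θ := by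
    simp [Finset.prod_range_succ', add_one_mul, add_assoc, add_comm α]
  have pochhammer_pos := ascPochhammer_pos (∑ b, m b) θ hθ
  have pochhammer_succ_pos := ascPochhammer_pos (∑ b, m b) (θ + 1) (by positivity)
  have pochhammer_shift := ascPochhammer_eval_add_one_mul (∑ b, m b) θ
  simp only [splitProb_mul_prod_ewensPitmanEPPF hτ m hm, ite_le_one]
  rw [← Finset.mul_sum, Finset.sum_add_distrib, ← splitWeightSum, ← splitWeightSum,
    splitWeightSum_zero, splitWeightSum_one, hsum, ewensPitmanEPPF, hl, Nat.add_sub_cancel,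
    prod_shift, Finset.prod_range_succ, show θ + α + 1 - α = θ + 1 by ring]
  generalize ∏ j ∈ Finset.range l, (θ + α + j * α) = Q
  generalize ∏ b, (ascPochhammer ℝ (m b - 1)).eval (1 - α) = R
  rw [div_mul_eq_mul_div, div_mul_eq_mul_div,
    div_eq_div_iff pochhammer_pos.ne' pochhammer_succ_pos.ne']
  push_cast at pochhammer_shift ⊢
  linear_combination Q * R * pochhammer_shift

theorem prod_ascPochhammer_nonneg (hα1 : α < 1) (m : B → ℕ) :
    0 ≤ ∏ b, (ascPochhammer ℝ (m b - 1)).eval (1 - α) :=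
  Finset.prod_nonneg fun _ _ => (ascPochhammer_pos _ _ (sub_pos.2 hα1)).le

theorem ewensPitmanEPPF_nonneg (hα0 : 0 ≤ α) (hα1 : α < 1) (hθ : 0 < θ) (m : B → ℕ) :
    0 ≤ ewensPitmanEPPF α θ m := by
  have := ascPochhammer_pos (∑ b, m b) θ hθ
  exact mul_nonneg (by positivity) (prod_ascPochhammer_nonneg hα1 m)

theorem ewensPitmanEPPF_le [Nonempty B] (hα0 : 0 ≤ α) (hα1 : α < 1) (hθ : 0 < θ) (m : B → ℕ)
    (hm : ∀ b, m b ≠ 0) :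
    ewensPitmanEPPF α θ m ≤ ∏ b, (ascPochhammer ℝ (m b - 1)).eval (1 - α) := by
  refine mul_le_of_le_one_left (prod_ascPochhammer_nonneg hα1 m) ?_
  rw [div_le_one (ascPochhammer_pos _ _ hθ)]
  refine prod_range_add_mul_le_ascPochhammer_eval hα0 hα1.le hθ Nat.card_pos.ne' ?_
  rw [Nat.card_eq_fintype_card, Fintype.card_eq_sum_ones]
  exact Finset.sum_le_sum fun b _ => Nat.one_le_iff_ne_zero.2 (hm b)

theorem ewensPitmanEPPF_of_isEmpty [IsEmpty B] (m : B → ℕ) : ewensPitmanEPPF α θ m = 1 := by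
  simp [ewensPitmanEPPF]

theorem ewensPitmanEPPF_comp_equiv {B' : Type*} [Fintype B'] (e : B' ≃ B) (m : B → ℕ) :
    ewensPitmanEPPF α θ (fun b => m (e b)) = ewensPitmanEPPF α θ m := by
  unfold ewensPitmanEPPF
  rw [e.sum_comp, e.prod_comp fun b => (ascPochhammer ℝ (m b - 1)).eval (1 - α), Nat.card_congr e]

end EwensPitman

section SplittingTree

variable {ι : Type*}

theorem crumbSize_append_singleton (D : List ι → Option ι → ℝ) (w : List ι) (i : ι) :
    crumbSize D (w ++ [i]) = D [] (some i) * crumbSize (fun u => D (u ++ [i])) w := by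
  induction w with
  | nil => simp [crumbSize]
  | cons j w ih => rw [List.cons_append, crumbSize, ih, crumbSize, mul_assoc]

theorem solidSize_append_singleton (D : List ι → Option ι → ℝ) (w : List ι) (i : ι) :
    solidSize D (w ++ [i]) = D [] (some i) * solidSize (fun u => D (u ++ [i])) w := by
  rw [solidSize, crumbSize_append_singleton, solidSize, mul_assoc]

theorem crumbSize_nonneg {D : List ι → Option ι → ℝ} (hD : ∀ v k, 0 ≤ D v k) (w : List ι) :
    0 ≤ crumbSize D w := by
  induction w with
  | nil => exact zero_le_one
  | cons i w ih => exact mul_nonneg ih (hD _ _)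

theorem solidSize_nonneg {D : List ι → Option ι → ℝ} (hD : ∀ v k, 0 ≤ D v k) (w : List ι) :
    0 ≤ solidSize D w :=
  mul_nonneg (crumbSize_nonneg hD w) (hD _ _)

theorem measurable_solidSize {Ω : Type*} {mΩ : MeasurableSpace Ω} {D : List ι → Ω → Option ι → ℝ}
    (hD : ∀ u k, Measurable fun ω => D u ω k) (w : List ι) :
    Measurable fun ω => solidSize (fun u => D u ω) w := by
  have measurable_crumbSize : ∀ w, Measurable fun ω => crumbSize (fun u => D u ω) w := by
    intro w
    induction w with
    | nil => exact measurable_const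
    | cons i w ih => exact ih.mul (hD _ _)
  exact (measurable_crumbSize w).mul (hD _ _)

/-- A nonempty word is split into its last letter, which is the first step away from the root of
the tree of words, and the rest. -/
def unsnocEmbedding (ι : Type*) : List ι ↪ Option ι × List ι where
  toFun w := match w.reverse with
    | [] => (none, [])
    | i :: t => (some i, t.reverse)
  inj' w w' h := by
    rcases w.eq_nil_or_concat with rfl | ⟨t, i, rfl⟩ <;>
      rcases w'.eq_nil_or_concat with rfl | ⟨t', i', rfl⟩ <;> simp_all

theorem unsnocEmbedding_nil : unsnocEmbedding ι [] = (none, []) := rfl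

theorem unsnocEmbedding_append_singleton (w : List ι) (i : ι) :
    unsnocEmbedding ι (w ++ [i]) = (some i, w) := by
  change (match (w ++ [i]).reverse with
    | [] => (none, [])
    | i :: t => (some i, t.reverse)) = _
  simp

/-- The restrictions of a function on words to the root and to the subtrees below it, the one at the
root being extended by zero. -/
noncomputable def restrictSubtree [DecidableEq ι] (x : List ι → ℝ≥0∞) : Option ι → List ι → ℝ≥0∞
  | none => Pi.single [] (x [])
  | some i => fun w => x (w ++ [i])

theorem restrictSubtree_unsnocEmbedding [DecidableEq ι] (x : List ι → ℝ≥0∞) (w : List ι) :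
    restrictSubtree x (unsnocEmbedding ι w).1 (unsnocEmbedding ι w).2 = x w := by
  rcases w.eq_nil_or_concat with rfl | ⟨t, i, rfl⟩
  · simp [unsnocEmbedding_nil, restrictSubtree]
  · rw [List.concat_eq_append, unsnocEmbedding_append_singleton, restrictSubtree]

theorem mem_range_unsnocEmbedding_of_restrictSubtree_ne_zero [DecidableEq ι] (x : List ι → ℝ≥0∞)
    (p : Option ι × List ι) (hp : restrictSubtree x p.1 p.2 ≠ 0) :
    p ∈ Set.range (unsnocEmbedding ι) := by
  obtain ⟨_ | i, w⟩ := p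
  · refine ⟨[], Prod.ext rfl ?_⟩
    by_contra hw
    exact hp (Pi.single_eq_of_ne (Ne.symm hw) _)
  · exact ⟨w ++ [i], unsnocEmbedding_append_singleton w i⟩

theorem tsum_list_eq [Fintype ι] (x : List ι → ℝ≥0∞) :
    ∑' w, x w = x [] + ∑ i, ∑' w, x (w ++ [i]) := by
  classical
  calc ∑' w, x w = ∑' p : Option ι × List ι, restrictSubtree x p.1 p.2 := by
        rw [← (unsnocEmbedding ι).injective.tsum_eq
          fun p hp => mem_range_unsnocEmbedding_of_restrictSubtree_ne_zero x p hp]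
        simp only [restrictSubtree_unsnocEmbedding]
    _ = x [] + ∑ i, ∑' w, x (w ++ [i]) := by
        rw [ENNReal.tsum_prod', tsum_fintype, Fintype.sum_option]
        simp only [restrictSubtree, tsum_pi_single]

theorem paintboxEPPF_list [Fintype ι] [DecidableEq ι] {B : Type*} [Fintype B] [DecidableEq B]
    (x : List ι → ℝ≥0∞) (m : B → ℕ) (hm : ∀ b, m b ≠ 0) :
    paintboxEPPF x m = ∑ f : B → Option ι,
      (if Nat.card {b // f b = none} ≤ 1 then x [] ^ ∑ b : {b // f b = none}, m b else 0) *
        ∏ i, paintboxEPPF (fun w => x (w ++ [i])) (fun b : {b // f b = some i} => m b) := by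
  calc paintboxEPPF x m
      = paintboxEPPF (fun p : Option ι × List ι => restrictSubtree x p.1 p.2) m := by
        rw [← paintboxEPPF_comp_of_support (unsnocEmbedding ι) _ m hm
          (mem_range_unsnocEmbedding_of_restrictSubtree_ne_zero x)]
        simp only [restrictSubtree_unsnocEmbedding]
    _ = _ := by
        rw [paintboxEPPF_prod]
        refine Finset.sum_congr rfl fun f _ => ?_
        rw [Fintype.prod_option]
        simp only [restrictSubtree, paintboxEPPF_single _ _ _ fun b : {b // f b = none} => hm b]

/-- The sizes of the solids in the subtree of the node `v`, relative to the crumb `v`. -/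
noncomputable def subtreeSolid (D : List ι → Option ι → ℝ) (v w : List ι) : ℝ≥0∞ :=
  ENNReal.ofReal (solidSize (fun u => D (u ++ v)) w)

theorem subtreeSolid_root (D : List ι → Option ι → ℝ) (w : List ι) :
    subtreeSolid D [] w = ENNReal.ofReal (solidSize D w) := by
  simp only [subtreeSolid, List.append_nil]

theorem subtreeSolid_nil (D : List ι → Option ι → ℝ) (v : List ι) :
    subtreeSolid D v [] = ENNReal.ofReal (D v none) := by
  simp [subtreeSolid, solidSize, crumbSize]

theorem subtreeSolid_append_singleton (D : List ι → Option ι → ℝ) (v w : List ι) (i : ι)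
    (h : 0 ≤ D v (some i)) :
    subtreeSolid D v (w ++ [i]) = ENNReal.ofReal (D v (some i)) * subtreeSolid D (i :: v) w := by
  rw [subtreeSolid, solidSize_append_singleton, List.nil_append, ENNReal.ofReal_mul h]
  simp [subtreeSolid]

theorem tsum_subtreeSolid_length_lt_le_one [Fintype ι] {D : List ι → Option ι → ℝ}
    (hD : ∀ v k, 0 ≤ D v k) (hsum : ∀ v, ∑ k, D v k = 1) (n : ℕ) (v : List ι) :
    ∑' w, (if w.length < n then subtreeSolid D v w else 0) ≤ 1 := by
  induction n generalizing v with
  | zero => simp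
  | succ n ih =>
    have sum_ofReal : ENNReal.ofReal (D v none) + ∑ i, ENNReal.ofReal (D v (some i)) = 1 := by
      rw [← Fintype.sum_option fun k => ENNReal.ofReal (D v k),
        ← ENNReal.ofReal_sum_of_nonneg fun k _ => hD v k, hsum, ENNReal.ofReal_one]
    calc ∑' w, (if w.length < n + 1 then subtreeSolid D v w else 0)
        = ENNReal.ofReal (D v none) + ∑ i, ENNReal.ofReal (D v (some i)) *
            ∑' w, (if w.length < n then subtreeSolid D (i :: v) w else 0) := by
          rw [tsum_list_eq]
          simp only [subtreeSolid_nil, subtreeSolid_append_singleton _ _ _ _ (hD _ _),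
            List.length_nil, List.length_append, List.length_singleton, Nat.zero_lt_succ,
            Nat.add_lt_add_iff_right, if_true, ← mul_ite_zero, ENNReal.tsum_mul_left]
      _ ≤ ENNReal.ofReal (D v none) + ∑ i, ENNReal.ofReal (D v (some i)) * 1 := by
          gcongr with i
          exact ih (i :: v)
      _ = 1 := by simpa only [mul_one] using sum_ofReal

theorem tsum_subtreeSolid_le_one [Fintype ι] {D : List ι → Option ι → ℝ}
    (hD : ∀ v k, 0 ≤ D v k) (hsum : ∀ v, ∑ k, D v k = 1) (v : List ι) :
    ∑' w, subtreeSolid D v w ≤ 1 := by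
  rw [ENNReal.tsum_eq_iSup_sum]
  refine iSup_le fun s => ?_
  calc ∑ w ∈ s, subtreeSolid D v w
      = ∑ w ∈ s, if w.length < s.sup List.length + 1 then subtreeSolid D v w else 0 :=
        Finset.sum_congr rfl fun w hw =>
          (if_pos (Nat.lt_succ_of_le (Finset.le_sup (f := List.length) hw))).symm
    _ ≤ _ := ENNReal.sum_le_tsum s
    _ ≤ 1 := tsum_subtreeSolid_length_lt_le_one hD hsum _ v

theorem paintboxEPPF_subtreeSolid [Fintype ι] [DecidableEq ι] {B : Type*} [Fintype B]
    [DecidableEq B] (D : List ι → Option ι → ℝ) (v : List ι) (hD : ∀ k, 0 ≤ D v k) (m : B → ℕ)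
    (hm : ∀ b, m b ≠ 0) :
    paintboxEPPF (subtreeSolid D v) m = ∑ f : B → Option ι, if Nat.card {b // f b = none} ≤ 1 then
      (∏ k, ENNReal.ofReal (D v k) ^ (∑ b : {b // f b = k}, m b)) *
        ∏ i, paintboxEPPF (subtreeSolid D (i :: v)) (fun b : {b // f b = some i} => m b)
      else 0 := by
  rw [paintboxEPPF_list _ m hm]
  refine Finset.sum_congr rfl fun f _ => ?_
  simp only [subtreeSolid_nil, subtreeSolid_append_singleton _ _ _ _ (hD _),
    paintboxEPPF_const_mul, Finset.prod_mul_distrib, Fintype.prod_option, ite_zero_mul, mul_assoc]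

end SplittingTree

section Independence

variable {Ω : Type*} {mΩ : MeasurableSpace Ω} {μ : Measure Ω}

theorem lintegral_prod_of_iIndep_of_pairwise_disjoint {T K : Type*} [IsProbabilityMeasure μ]
    {m : T → MeasurableSpace Ω} (hle : ∀ t, m t ≤ mΩ) (hindep : iIndep m μ) (S : K → Set T)
    (hS : Pairwise (Function.onFun Disjoint S)) (F : K → Ω → ℝ≥0∞)
    (hF : ∀ k, Measurable[⨆ t ∈ S k, m t] (F k)) (s : Finset K) :
    ∫⁻ ω, ∏ k ∈ s, F k ω ∂μ = ∏ k ∈ s, ∫⁻ ω, F k ω ∂μ := by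
  classical
  induction s using Finset.induction_on with
  | empty => simp
  | insert k s hk ih =>
    simp only [Finset.prod_insert hk]
    rw [← ih]
    have disjoint_rest : Disjoint (S k) (⋃ k' ∈ s, S k') := by
      rw [Set.disjoint_iUnion₂_right]
      exact fun k' hk' => hS fun h => hk (h ▸ hk')
    refine lintegral_mul_eq_lintegral_mul_lintegral_of_independent_measurableSpace
      (iSup₂_le fun t _ => hle t) (iSup₂_le fun t _ => hle t)
      (indep_iSup_of_disjoint hle hindep disjoint_rest) (hF k) ?_
    refine Finset.measurable_prod _ fun k' hk' => (hF k').mono ?_ le_rfl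
    exact iSup₂_le fun t ht => le_iSup₂_of_le t (Set.mem_biUnion hk' ht) le_rfl

variable {ι : Type*}

theorem measurable_paintboxEPPF {B J : Type*} [Fintype B] [Countable J] {x : Ω → J → ℝ≥0∞}
    (hx : ∀ j, Measurable fun ω => x ω j) (m : B → ℕ) :
    Measurable fun ω => paintboxEPPF (x ω) m := by
  have : Countable (B ↪ J) := DFunLike.coe_injective.countable
  exact Measurable.tsum fun c => Finset.measurable_prod _ fun b _ => (hx _).pow_const _

theorem measurable_paintboxEPPF_subtreeSolid [Countable ι] {B : Type*} [Fintype B]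
    (D : List ι → Ω → Option ι → ℝ) (v : List ι) (m : B → ℕ) :
    Measurable[⨆ u ∈ Set.range (· ++ v), MeasurableSpace.comap (D u) inferInstance]
      fun ω => paintboxEPPF (subtreeSolid (fun u => D u ω) v) m := by
  refine measurable_paintboxEPPF (fun w => ENNReal.measurable_ofReal.comp ?_) m
  refine measurable_solidSize (D := fun u => D (u ++ v)) (fun u k => ?_) w
  have measurable_node :
      Measurable[⨆ u ∈ Set.range (· ++ v), MeasurableSpace.comap (D u) inferInstance]
        (D (u ++ v)) :=
    measurable_iff_comap_le.2 (le_iSup₂_of_le (u ++ v) ⟨u, rfl⟩ le_rfl)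
  exact (measurable_pi_apply k).comp measurable_node

theorem measurable_prod_ofReal_pow [Fintype ι] (X : Ω → Option ι → ℝ) (r : Option ι → ℕ) :
    Measurable[MeasurableSpace.comap X inferInstance]
      fun ω => ∏ k, ENNReal.ofReal (X ω k) ^ r k :=
  Finset.measurable_prod _ fun k _ => Measurable.pow_const
    (ENNReal.measurable_ofReal.comp ((measurable_pi_apply k).comp (comap_measurable X))) _

/-- The node `v` itself, and the subtrees of its children. -/
def descendants (v : List ι) : Option ι → Set (List ι)
  | none => {v}
  | some i => Set.range (· ++ i :: v)

theorem pairwise_disjoint_descendants (v : List ι) :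
    Pairwise (Function.onFun Disjoint (descendants v)) := by
  have append_ne : ∀ i (u : List ι), u ++ i :: v ≠ v := fun i u hu => by
    have := congrArg List.length hu
    simp only [List.length_append, List.length_cons] at this
    omega
  intro k k' hk
  rw [Function.onFun, Set.disjoint_left]
  rcases k with _ | i <;> rcases k' with _ | i'
  · exact (hk rfl).elim
  · rintro u hu ⟨u', hu'⟩
    exact append_ne i' u' (hu'.trans hu)
  · rintro _ ⟨u', rfl⟩ hu
    exact append_ne i u' hu
  · rintro _ ⟨u, rfl⟩ ⟨u', hu'⟩
    have := (List.append_inj' hu' (by simp)).2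
    simp only [List.cons.injEq, and_true] at this
    exact hk (by rw [this])

end Independence

section SplittingScheme

variable {ι Ω : Type*} {mΩ : MeasurableSpace Ω} {μ : Measure Ω}

/-- `D` is a random splitting scheme: the nodes split independently, the pieces of the node `v`
having the mixed moments of the Dirichlet distribution with parameters `τ (i :: v)` and `1 - α`. The
parameters add up in such a way that `τ v` is the parameter `θ` of the partition generated from the
subtree of `v`. -/
structure IsSplittingScheme [Fintype ι] (μ : Measure Ω) (α : ℝ) (τ : List ι → ℝ)
    (D : List ι → Ω → Option ι → ℝ) : Prop where
  measurable : ∀ v, Measurable (D v)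
  indep : iIndepFun D μ
  nonneg : ∀ v, ∀ᵐ ω ∂μ, ∀ k, 0 ≤ D v ω k
  sum_eq_one : ∀ v, ∀ᵐ ω ∂μ, ∑ k, D v ω k = 1
  moment : ∀ v (r : Option ι → ℕ), ∫⁻ ω, ∏ k, ENNReal.ofReal (D v ω k) ^ r k ∂μ =
    ENNReal.ofReal (dirichletMoment (splitParam α fun i => τ (i :: v)) r)
  pos : ∀ v, 0 < τ v
  sum_param : ∀ v, ∑ i, τ (i :: v) = τ v + α

/-- The exchangeable partition probability function of the random paintbox formed by the solids in
the subtree of `v`, relative to the crumb `v`. -/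
noncomputable def subtreeEPPF (μ : Measure Ω) (D : List ι → Ω → Option ι → ℝ) (v : List ι)
    {B : Type*} [Fintype B] (m : B → ℕ) : ℝ≥0∞ :=
  ∫⁻ ω, paintboxEPPF (subtreeSolid (fun u => D u ω) v) m ∂μ

theorem subtreeEPPF_comp_equiv (D : List ι → Ω → Option ι → ℝ) (v : List ι) {B B' : Type*}
    [Fintype B] [Fintype B'] (e : B' ≃ B) (m : B → ℕ) :
    subtreeEPPF μ D v (fun b => m (e b)) = subtreeEPPF μ D v m :=
  lintegral_congr fun _ => paintboxEPPF_comp_equiv e _ m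

theorem subtreeEPPF_of_isEmpty [IsProbabilityMeasure μ] (D : List ι → Ω → Option ι → ℝ)
    (v : List ι) {B : Type*} [Fintype B] [IsEmpty B] (m : B → ℕ) : subtreeEPPF μ D v m = 1 := by
  simp [subtreeEPPF, paintboxEPPF_of_isEmpty]

namespace IsSplittingScheme

variable [Fintype ι] {α : ℝ} {τ : List ι → ℝ} {D : List ι → Ω → Option ι → ℝ}

theorem ae_nonneg (h : IsSplittingScheme μ α τ D) : ∀ᵐ ω ∂μ, ∀ v k, 0 ≤ D v ω k :=
  ae_all_iff.2 h.nonneg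

theorem ae_tsum_subtreeSolid_le_one (h : IsSplittingScheme μ α τ D) (v : List ι) :
    ∀ᵐ ω ∂μ, ∑' w, subtreeSolid (fun u => D u ω) v w ≤ 1 := by
  filter_upwards [h.ae_nonneg, ae_all_iff.2 h.sum_eq_one] with ω hnonneg hsum
  exact tsum_subtreeSolid_le_one hnonneg hsum v

theorem subtreeEPPF_le_one [IsProbabilityMeasure μ] (h : IsSplittingScheme μ α τ D) (v : List ι)
    {B : Type*} [Fintype B] (m : B → ℕ) (hm : ∀ b, m b ≠ 0) : subtreeEPPF μ D v m ≤ 1 :=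
  calc subtreeEPPF μ D v m ≤ ∫⁻ _, 1 ∂μ := by
        refine lintegral_mono_ae ?_
        filter_upwards [h.ae_tsum_subtreeSolid_le_one v] with ω hω
        exact paintboxEPPF_le_one _ m hm hω
    _ = 1 := by simp

theorem subtreeEPPF_ne_top [IsProbabilityMeasure μ] (h : IsSplittingScheme μ α τ D) (v : List ι)
    {B : Type*} [Fintype B] (m : B → ℕ) (hm : ∀ b, m b ≠ 0) : subtreeEPPF μ D v m ≠ ∞ :=
  ((h.subtreeEPPF_le_one v m hm).trans_lt ENNReal.one_lt_top).ne

theorem measurable_prod_mul_prod_paintboxEPPF (h : IsSplittingScheme μ α τ D) (v : List ι)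
    (r : Option ι → ℕ) {B : ι → Type*} [∀ i, Fintype (B i)] (m : ∀ i, B i → ℕ) :
    Measurable fun ω => (∏ k, ENNReal.ofReal (D v ω k) ^ r k) *
      ∏ i, paintboxEPPF (subtreeSolid (fun u => D u ω) (i :: v)) (m i) :=
  ((measurable_prod_ofReal_pow (D v) r).mono (h.measurable v).comap_le le_rfl).mul <|
    Finset.measurable_prod _ fun i _ =>
      (measurable_paintboxEPPF_subtreeSolid D (i :: v) (m i)).mono
        (iSup₂_le fun u _ => (h.measurable u).comap_le) le_rfl

theorem lintegral_prod_mul_prod_paintboxEPPF [IsProbabilityMeasure μ]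
    (h : IsSplittingScheme μ α τ D) (v : List ι) (r : Option ι → ℕ) {B : ι → Type*}
    [∀ i, Fintype (B i)] (m : ∀ i, B i → ℕ) :
    ∫⁻ ω, (∏ k, ENNReal.ofReal (D v ω k) ^ r k) *
        ∏ i, paintboxEPPF (subtreeSolid (fun u => D u ω) (i :: v)) (m i) ∂μ =
      ENNReal.ofReal (dirichletMoment (splitParam α fun i => τ (i :: v)) r) *
        ∏ i, subtreeEPPF μ D (i :: v) (m i) := by
  let F : Option ι → Ω → ℝ≥0∞ := fun k => match k with
    | none => fun ω => ∏ k, ENNReal.ofReal (D v ω k) ^ r k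
    | some i => fun ω => paintboxEPPF (subtreeSolid (fun u => D u ω) (i :: v)) (m i)
  have measurable_F : ∀ k, Measurable[⨆ u ∈ descendants v k,
      MeasurableSpace.comap (D u) inferInstance] (F k) := by
    rintro (_ | i)
    · exact (measurable_prod_ofReal_pow (D v) r).mono (le_iSup₂_of_le v rfl le_rfl) le_rfl
    · exact measurable_paintboxEPPF_subtreeSolid D (i :: v) _
  have lintegral_prod := lintegral_prod_of_iIndep_of_pairwise_disjoint
    (fun u => (h.measurable u).comap_le) h.indep _ (pairwise_disjoint_descendants v) F
    measurable_F Finset.univ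
  simp only [Fintype.prod_option (fun k => F k _), Fintype.prod_option] at lintegral_prod
  rw [← h.moment v]
  exact lintegral_prod

theorem subtreeEPPF_eq_sum_splitProb [IsProbabilityMeasure μ] [DecidableEq ι]
    (h : IsSplittingScheme μ α τ D) (v : List ι) {B : Type*} [Fintype B] [DecidableEq B]
    (m : B → ℕ) (hm : ∀ b, m b ≠ 0) :
    subtreeEPPF μ D v m = ∑ f : B → Option ι,
      ENNReal.ofReal (splitProb (splitParam α fun i => τ (i :: v)) m f) *
        ∏ i, subtreeEPPF μ D (i :: v) (fun b : {b // f b = some i} => m b) := by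
  have paintboxEPPF_ae_eq : (fun ω => paintboxEPPF (subtreeSolid (fun u => D u ω) v) m) =ᵐ[μ]
      fun ω => ∑ f : B → Option ι, if Nat.card {b // f b = none} ≤ 1 then
        (∏ k, ENNReal.ofReal (D v ω k) ^ (∑ b : {b // f b = k}, m b)) *
          ∏ i, paintboxEPPF (subtreeSolid (fun u => D u ω) (i :: v))
            (fun b : {b // f b = some i} => m b) else 0 := by
    filter_upwards [h.nonneg v] with ω hω
    exact paintboxEPPF_subtreeSolid (fun u => D u ω) v hω m hm
  rw [subtreeEPPF, lintegral_congr_ae paintboxEPPF_ae_eq, lintegral_finsetSum]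
  · refine Finset.sum_congr rfl fun f _ => ?_
    unfold splitProb
    split_ifs with hf
    · exact h.lintegral_prod_mul_prod_paintboxEPPF v _ _
    · simp
  · intro f _
    split_ifs
    · exact h.measurable_prod_mul_prod_paintboxEPPF v _ _
    · exact measurable_const

end IsSplittingScheme

end SplittingScheme

section Contraction

theorem splitParam_pos {ι : Type*} {α : ℝ} (hα1 : α < 1) {τ : ι → ℝ} (hτ : ∀ i, 0 < τ i) :
    ∀ k, 0 < splitParam α τ k
  | none => sub_pos.2 hα1
  | some i => hτ i

variable {B ι K : Type*} [Fintype B] [Fintype ι] [Fintype K] {α : ℝ}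

theorem ascPochhammer_eval_div_le {x y : ℝ} (hx : 0 < x) (hxy : x ≤ y) {n : ℕ} (hn : n ≠ 0) :
    (ascPochhammer ℝ n).eval x / (ascPochhammer ℝ n).eval y ≤ x / y := by
  have hy := hx.trans_le hxy
  obtain ⟨n, rfl⟩ := Nat.exists_eq_succ_of_ne_zero hn
  clear hn
  induction n with
  | zero => simp
  | succ n ih =>
    have quotient_nonneg :
        0 ≤ (ascPochhammer ℝ (n + 1)).eval x / (ascPochhammer ℝ (n + 1)).eval y :=
      div_nonneg (ascPochhammer_pos _ x hx).le (ascPochhammer_pos _ y hy).le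
    have last_factor_le_one : (x + (n + 1 : ℕ)) / (y + (n + 1 : ℕ)) ≤ 1 := by
      rw [div_le_one (by positivity)]
      linarith
    rw [Nat.succ_eq_add_one, ascPochhammer_succ_eval (n + 1) x, ascPochhammer_succ_eval (n + 1) y,
      mul_div_mul_comm]
    exact (mul_le_of_le_one_right quotient_nonneg last_factor_le_one).trans ih

theorem dirichletMoment_nonneg {a : K → ℝ} (ha : ∀ k, 0 < a k) (r : K → ℕ) :
    0 ≤ dirichletMoment a r := by
  refine div_nonneg (Finset.prod_nonneg fun k _ => (ascPochhammer_pos _ _ (ha k)).le) ?_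
  rcases isEmpty_or_nonempty K with h | h
  · simp
  · exact (ascPochhammer_pos _ _ (Finset.sum_pos (fun k _ => ha k) Finset.univ_nonempty)).le

theorem dirichletMoment_single_le [DecidableEq K] {a : K → ℝ} (ha : ∀ k, 0 < a k) (k : K) {n : ℕ}
    (hn : n ≠ 0) : dirichletMoment a (Pi.single k n) ≤ a k / ∑ k, a k := by
  unfold dirichletMoment
  rw [Fintype.prod_eq_single k fun k' hk => by simp [hk], Fintype.sum_pi_single', Pi.single_eq_same]
  exact ascPochhammer_eval_div_le (ha k)
    (Finset.single_le_sum (f := a) (fun k _ => (ha k).le) (Finset.mem_univ k)) hn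

theorem splitProb_nonneg [DecidableEq ι] {a : Option ι → ℝ} (ha : ∀ k, 0 < a k) (m : B → ℕ)
    (f : B → Option ι) : 0 ≤ splitProb a m f := by
  unfold splitProb
  split_ifs
  exacts [dirichletMoment_nonneg ha _, le_rfl]

theorem splitProb_const_some_le [DecidableEq ι] [Nonempty B] {a : Option ι → ℝ}
    (ha : ∀ k, 0 < a k) (m : B → ℕ) (hm : ∀ b, m b ≠ 0) (i : ι) :
    splitProb a m (fun _ => some i) ≤ a (some i) / ∑ k, a k := by
  have sum_fiber :
      (fun k => ∑ b : {_b : B // some i = k}, m b) = Pi.single (some i) (∑ b, m b) := by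
    funext k
    by_cases hk : some i = k
    · subst hk
      rw [Pi.single_eq_same]
      exact (Equiv.subtypeUnivEquiv fun _ => rfl).sum_comp m
    · have : IsEmpty {_b : B // some i = k} := ⟨fun b => hk b.2⟩
      rw [Pi.single_eq_of_ne (Ne.symm hk), Finset.univ_eq_empty, Finset.sum_empty]
  rw [splitProb, if_pos (by simp), sum_fiber]
  exact dirichletMoment_single_le ha _
    (Finset.sum_pos (fun b _ => Nat.pos_of_ne_zero (hm b)) Finset.univ_nonempty).ne'

theorem one_sub_div_mul_add_nonneg (hα0 : 0 ≤ α) {T : ℝ} (hT : 0 < T) (l : ℕ) :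
    0 ≤ 1 - (1 - α) / (T + l * α + 1) := by
  have : 0 ≤ l * α := by positivity
  rw [sub_nonneg, div_le_one (by positivity)]
  linarith

theorem tendsto_prod_one_sub_div (hα0 : 0 ≤ α) (hα1 : α < 1) {T : ℝ} (hT : 0 < T) :
    Filter.Tendsto (fun k => ∏ l ∈ Finset.range k, (1 - (1 - α) / (T + l * α + 1)))
      Filter.atTop (nhds 0) := by
  have harmonic_le : ∀ l : ℕ,
      (1 - α) / (T + 1) * (1 / ((l : ℝ) + 1)) ≤ (1 - α) / (T + l * α + 1) := by
    intro l
    rw [mul_one_div, div_div, div_le_div_iff_of_pos_left (by linarith) (by positivity)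
      (by positivity)]
    have : l * α ≤ l := mul_le_of_le_one_right l.cast_nonneg hα1.le
    nlinarith [mul_nonneg hT.le (l.cast_nonneg : (0 : ℝ) ≤ l)]
  have prod_le_exp : ∀ k, ∏ l ∈ Finset.range k, (1 - (1 - α) / (T + l * α + 1)) ≤
      Real.exp (-((1 - α) / (T + 1) * ∑ l ∈ Finset.range k, 1 / ((l : ℝ) + 1))) := by
    intro k
    rw [Finset.mul_sum, ← Finset.sum_neg_distrib, Real.exp_sum]
    refine Finset.prod_le_prod (fun l _ => one_sub_div_mul_add_nonneg hα0 hT l) fun l _ => ?_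
    exact (sub_le_sub_left (harmonic_le l) 1).trans (Real.one_sub_le_exp_neg _)
  refine squeeze_zero (fun k => Finset.prod_nonneg fun l _ => one_sub_div_mul_add_nonneg hα0 hT l)
    prod_le_exp (Real.tendsto_exp_neg_atTop_nhds_zero.comp ?_)
  exact Real.tendsto_sum_range_one_div_nat_succ_atTop.const_mul_atTop
    (div_pos (sub_pos.2 hα1) (by positivity))

end Contraction

section EPPFError

variable {B ι Ω : Type*} [Fintype B] [Fintype ι] {mΩ : MeasurableSpace Ω} {μ : Measure Ω}
  {α : ℝ} {τ : List ι → ℝ} {D : List ι → Ω → Option ι → ℝ}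

theorem prod_subtreeEPPF_const_some [IsProbabilityMeasure μ] [DecidableEq ι]
    (D : List ι → Ω → Option ι → ℝ) (v : List ι) (m : B → ℕ) (i : ι) :
    ∏ j, subtreeEPPF μ D (j :: v) (fun b : {_b : B // some i = some j} => m b) =
      subtreeEPPF μ D (i :: v) m := by
  rw [Fintype.prod_eq_single i]
  · exact subtreeEPPF_comp_equiv D _ (Equiv.subtypeUnivEquiv fun _ => rfl) m
  · intro j hj
    have : IsEmpty {_b : B // some i = some j} := ⟨fun b => hj (Option.some.inj b.2).symm⟩
    exact subtreeEPPF_of_isEmpty D _ _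

theorem prod_ewensPitmanEPPF_const_some [DecidableEq ι] (α : ℝ) (τ : ι → ℝ) (m : B → ℕ) (i : ι) :
    ∏ j, ewensPitmanEPPF α (τ j) (fun b : {_b : B // some i = some j} => m b) =
      ewensPitmanEPPF α (τ i) m := by
  rw [Fintype.prod_eq_single i]
  · exact ewensPitmanEPPF_comp_equiv (Equiv.subtypeUnivEquiv fun _ => rfl) m
  · intro j hj
    have : IsEmpty {_b : B // some i = some j} := ⟨fun b => hj (Option.some.inj b.2).symm⟩
    exact ewensPitmanEPPF_of_isEmpty _

/-- The deviation of the partition probability function of the subtree of `v` from the Ewens–Pitman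
one with parameters `(α, τ v)`. -/
noncomputable def eppfError (μ : Measure Ω) (D : List ι → Ω → Option ι → ℝ) (α : ℝ) (τ : List ι → ℝ)
    (v : List ι) {B : Type*} [Fintype B] (m : B → ℕ) : ℝ :=
  (subtreeEPPF μ D v m).toReal - ewensPitmanEPPF α (τ v) m

namespace IsSplittingScheme

variable [IsProbabilityMeasure μ]

theorem subtreeEPPF_toReal_eq_sum_splitProb [DecidableEq ι] [DecidableEq B]
    (h : IsSplittingScheme μ α τ D) (hα1 : α < 1) (v : List ι) (m : B → ℕ) (hm : ∀ b, m b ≠ 0) :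
    (subtreeEPPF μ D v m).toReal = ∑ f : B → Option ι,
      splitProb (splitParam α fun i => τ (i :: v)) m f *
        ∏ i, (subtreeEPPF μ D (i :: v) (fun b : {b // f b = some i} => m b)).toReal := by
  rw [h.subtreeEPPF_eq_sum_splitProb v m hm, ENNReal.toReal_sum]
  · refine Finset.sum_congr rfl fun f _ => ?_
    rw [ENNReal.toReal_mul, ENNReal.toReal_prod,
      ENNReal.toReal_ofReal (splitProb_nonneg (splitParam_pos hα1 fun i => h.pos _) m f)]
  · exact fun f _ => ENNReal.mul_ne_top ENNReal.ofReal_ne_top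
      (ENNReal.prod_ne_top fun i _ => h.subtreeEPPF_ne_top _ _ fun b => hm b)

theorem eppfError_eq_sum_splitProb [DecidableEq ι] [DecidableEq B] [Nonempty B]
    (h : IsSplittingScheme μ α τ D) (hα1 : α < 1) (v : List ι) (m : B → ℕ) (hm : ∀ b, m b ≠ 0) :
    eppfError μ D α τ v m = ∑ f : B → Option ι,
      splitProb (splitParam α fun i => τ (i :: v)) m f *
        (∏ i, (subtreeEPPF μ D (i :: v) (fun b : {b // f b = some i} => m b)).toReal -
          ∏ i, ewensPitmanEPPF α (τ (i :: v)) (fun b : {b // f b = some i} => m b)) := by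
  rw [eppfError, h.subtreeEPPF_toReal_eq_sum_splitProb hα1 v m hm,
    ewensPitmanEPPF_eq_sum_splitProb (h.pos v) (fun i => h.pos (i :: v)) (h.sum_param v) m hm,
    ← Finset.sum_sub_distrib]
  simp only [mul_sub]

theorem eppfError_eq_sum_const_some [DecidableEq ι] [Nonempty B] (h : IsSplittingScheme μ α τ D)
    (hα1 : α < 1) (v : List ι) (m : B → ℕ) (hm : ∀ b, m b ≠ 0)
    (ih : ∀ (s : B → Prop) [DecidablePred s] (v : List ι), Nat.card {b // s b} < Nat.card B →
      eppfError μ D α τ v (fun b : {b // s b} => m b) = 0) :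
    eppfError μ D α τ v m = ∑ i, splitProb (splitParam α fun i => τ (i :: v)) m (fun _ => some i) *
      eppfError μ D α τ (i :: v) m := by
  classical
  have const_injective : Function.Injective fun (i : ι) (_ : B) => some i := fun i j hij =>
    Option.some.inj (congrFun hij (Classical.arbitrary B))
  rw [h.eppfError_eq_sum_splitProb hα1 v m hm,
    ← Finset.sum_subset (Finset.subset_univ (Finset.univ.image fun (i : ι) (_ : B) => some i)),
    Finset.sum_image fun i _ j _ hij => const_injective hij]
  · simp only [← ENNReal.toReal_prod, prod_subtreeEPPF_const_some,
      prod_ewensPitmanEPPF_const_some α fun i => τ (i :: v), eppfError]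
  · intro f _ hf
    refine mul_eq_zero_of_right _ (sub_eq_zero.2 (Finset.prod_congr rfl fun i _ => ?_))
    obtain ⟨b, hb⟩ : ∃ b, f b ≠ some i := by
      by_contra! hcon
      exact hf (Finset.mem_image.2 ⟨i, Finset.mem_univ i, (funext hcon).symm⟩)
    exact sub_eq_zero.1 (ih (fun b => f b = some i) (i :: v) (Finite.card_subtype_lt hb))

theorem abs_eppfError_le_sum [Nonempty B] (h : IsSplittingScheme μ α τ D) (hα1 : α < 1)
    (v : List ι) (m : B → ℕ) (hm : ∀ b, m b ≠ 0)
    (ih : ∀ (s : B → Prop) [DecidablePred s] (v : List ι), Nat.card {b // s b} < Nat.card B →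
      eppfError μ D α τ v (fun b : {b // s b} => m b) = 0) :
    |eppfError μ D α τ v m| ≤
      ∑ i, τ (i :: v) / (τ v + 1) * |eppfError μ D α τ (i :: v) m| := by
  classical
  have param_pos := splitParam_pos hα1 fun i => h.pos (i :: v)
  have sum_param : ∑ k, splitParam α (fun i => τ (i :: v)) k = τ v + 1 := by
    rw [sum_splitParam, h.sum_param]
    ring
  rw [h.eppfError_eq_sum_const_some hα1 v m hm ih]
  refine (Finset.abs_sum_le_sum_abs _ _).trans (Finset.sum_le_sum fun i _ => ?_)
  rw [abs_mul, abs_of_nonneg (splitProb_nonneg param_pos m _), ← sum_param]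
  exact mul_le_mul_of_nonneg_right (splitProb_const_some_le param_pos m hm i) (abs_nonneg _)

theorem abs_eppfError_le [Nonempty B] (h : IsSplittingScheme μ α τ D) (hα0 : 0 ≤ α) (hα1 : α < 1)
    (v : List ι) (m : B → ℕ) (hm : ∀ b, m b ≠ 0) :
    |eppfError μ D α τ v m| ≤ 1 + ∏ b, (ascPochhammer ℝ (m b - 1)).eval (1 - α) := by
  have subtree_le_one : (subtreeEPPF μ D v m).toReal ≤ 1 :=
    ENNReal.toReal_le_of_le_ofReal zero_le_one (by simpa using h.subtreeEPPF_le_one v m hm)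
  have subtree_nonneg : 0 ≤ (subtreeEPPF μ D v m).toReal := ENNReal.toReal_nonneg
  have ewensPitman_nonneg := ewensPitmanEPPF_nonneg hα0 hα1 (h.pos v) m
  have ewensPitman_le := ewensPitmanEPPF_le hα0 hα1 (h.pos v) m hm
  rw [eppfError, abs_le]
  constructor <;> linarith

theorem abs_eppfError_le_one_sub_div_mul [Nonempty B] (h : IsSplittingScheme μ α τ D)
    (hα1 : α < 1) {v : List ι} {T : ℝ} (hT : τ v ≤ T) (m : B → ℕ) (hm : ∀ b, m b ≠ 0)
    (ih : ∀ (s : B → Prop) [DecidablePred s] (v : List ι), Nat.card {b // s b} < Nat.card B →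
      eppfError μ D α τ v (fun b : {b // s b} => m b) = 0)
    {E : ℝ} (hE0 : 0 ≤ E) (hE : ∀ i, |eppfError μ D α τ (i :: v) m| ≤ E) :
    |eppfError μ D α τ v m| ≤ (1 - (1 - α) / (T + 1)) * E := by
  have hτ := h.pos v
  calc |eppfError μ D α τ v m|
      ≤ ∑ i, τ (i :: v) / (τ v + 1) * |eppfError μ D α τ (i :: v) m| :=
        h.abs_eppfError_le_sum hα1 v m hm ih
    _ ≤ ∑ i, τ (i :: v) / (τ v + 1) * E := Finset.sum_le_sum fun i _ =>
        mul_le_mul_of_nonneg_left (hE i) (div_nonneg (h.pos _).le (by linarith))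
    _ = (1 - (1 - α) / (τ v + 1)) * E := by
        rw [← Finset.sum_mul, ← Finset.sum_div, h.sum_param]
        field_simp
        ring
    _ ≤ (1 - (1 - α) / (T + 1)) * E := by
        have : 0 ≤ 1 - α := by linarith
        gcongr

theorem abs_eppfError_le_prod [Nonempty B] (h : IsSplittingScheme μ α τ D) (hα0 : 0 ≤ α)
    (hα1 : α < 1) (m : B → ℕ) (hm : ∀ b, m b ≠ 0)
    (ih : ∀ (s : B → Prop) [DecidablePred s] (v : List ι), Nat.card {b // s b} < Nat.card B →
      eppfError μ D α τ v (fun b : {b // s b} => m b) = 0) (k : ℕ) {v : List ι} {T : ℝ}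
    (hT : τ v ≤ T) :
    |eppfError μ D α τ v m| ≤ (∏ l ∈ Finset.range k, (1 - (1 - α) / (T + l * α + 1))) *
      (1 + ∏ b, (ascPochhammer ℝ (m b - 1)).eval (1 - α)) := by
  induction k generalizing v T with
  | zero => simpa using h.abs_eppfError_le hα0 hα1 v m hm
  | succ k ihk =>
    have child_param_le : ∀ i, τ (i :: v) ≤ T + α := fun i =>
      calc τ (i :: v) ≤ ∑ i, τ (i :: v) := Finset.single_le_sum (f := fun i => τ (i :: v))
            (fun i _ => (h.pos (i :: v)).le) (Finset.mem_univ i)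
        _ = τ v + α := h.sum_param v
        _ ≤ T + α := by linarith
    have shift : ∀ l : ℕ, T + ((l + 1 : ℕ) : ℝ) * α + 1 = T + α + l * α + 1 := fun l => by
      push_cast
      ring
    have factor_nonneg := one_sub_div_mul_add_nonneg hα0
      (show 0 < T + α by linarith [h.pos v])
    simp only [Finset.prod_range_succ', shift, Nat.cast_zero, zero_mul, add_zero]
    rw [mul_comm (∏ l ∈ _, _), mul_assoc]
    exact h.abs_eppfError_le_one_sub_div_mul hα1 hT m hm ih
      (mul_nonneg (Finset.prod_nonneg fun l _ => factor_nonneg l)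
        (add_nonneg zero_le_one (prod_ascPochhammer_nonneg hα1 m)))
      fun i => ihk (child_param_le i)

theorem eppfError_eq_zero (h : IsSplittingScheme μ α τ D) (hα0 : 0 ≤ α) (hα1 : α < 1)
    (m : B → ℕ) (hm : ∀ b, m b ≠ 0) (v : List ι) : eppfError μ D α τ v m = 0 := by
  induction hn : Nat.card B using Nat.strong_induction_on generalizing B v with
  | _ n ih =>
    rcases isEmpty_or_nonempty B with hB | hB
    · rw [eppfError, subtreeEPPF_of_isEmpty, ewensPitmanEPPF_of_isEmpty, ENNReal.toReal_one,
        sub_self]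
    · have bound_tendsto := (tendsto_prod_one_sub_div hα0 hα1 (h.pos v)).mul_const
        (1 + ∏ b, (ascPochhammer ℝ (m b - 1)).eval (1 - α))
      rw [zero_mul] at bound_tendsto
      exact abs_nonpos_iff.1 (ge_of_tendsto' bound_tendsto fun k =>
        h.abs_eppfError_le_prod hα0 hα1 m hm
          (fun s _ v hs => ih _ (hn ▸ hs) (fun b : {b // s b} => m b)
            (fun b => hm b) v rfl) k le_rfl)

theorem subtreeEPPF_eq (h : IsSplittingScheme μ α τ D) (hα0 : 0 ≤ α) (hα1 : α < 1)
    (m : B → ℕ) (hm : ∀ b, m b ≠ 0) (v : List ι) :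
    subtreeEPPF μ D v m = ENNReal.ofReal (ewensPitmanEPPF α (τ v) m) := by
  rw [← sub_eq_zero.1 (h.eppfError_eq_zero hα0 hα1 m hm v),
    ENNReal.ofReal_toReal (h.subtreeEPPF_ne_top v m hm)]

theorem ae_tsum_ofReal_solidSize_eq_one (h : IsSplittingScheme μ α τ D) (hα0 : 0 ≤ α)
    (hα1 : α < 1) : ∀ᵐ ω ∂μ, ∑' w, ENNReal.ofReal (solidSize (fun v => D v ω) w) = 1 := by
  have lintegral_eq_one : ∫⁻ ω, ∑' w, subtreeSolid (fun u => D u ω) [] w ∂μ = 1 := by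
    have := h.subtreeEPPF_eq hα0 hα1 (fun _ : Unit => 1) (fun _ => one_ne_zero) []
    simpa [subtreeEPPF, paintboxEPPF_of_unique, ewensPitmanEPPF, (h.pos []).ne'] using this
  have ae_eq_one : (fun ω => ∑' w, subtreeSolid (fun u => D u ω) [] w) =ᵐ[μ] fun _ => 1 :=
    ae_eq_of_ae_le_of_lintegral_le (h.ae_tsum_subtreeSolid_le_one [])
      (by simp [lintegral_eq_one]) aemeasurable_const (by simp [lintegral_eq_one])
  filter_upwards [ae_eq_one] with ω hω
  simpa only [subtreeSolid_root] using hω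

theorem ae_hasSum_solidSize (h : IsSplittingScheme μ α τ D) (hα0 : 0 ≤ α) (hα1 : α < 1) :
    ∀ᵐ ω ∂μ, (∀ w, 0 ≤ solidSize (fun v => D v ω) w) ∧
      HasSum (solidSize fun v => D v ω) 1 := by
  filter_upwards [h.ae_nonneg, h.ae_tsum_ofReal_solidSize_eq_one hα0 hα1] with ω hnonneg hsum
  have solid_nonneg := solidSize_nonneg hnonneg
  have hasSum_toReal := ENNReal.hasSum_toReal (hsum.trans_ne ENNReal.one_ne_top)
  rw [← ENNReal.tsum_toReal_eq fun w => ENNReal.ofReal_ne_top, hsum,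
    ENNReal.toReal_one] at hasSum_toReal
  exact ⟨solid_nonneg, by simpa only [ENNReal.toReal_ofReal (solid_nonneg _)] using hasSum_toReal⟩

end IsSplittingScheme

end EPPFError

section GammaBetaDirichlet

theorem gamma_add_natCast {a : ℝ} (ha : 0 < a) (n : ℕ) :
    Real.Gamma (a + n) = (ascPochhammer ℝ n).eval a * Real.Gamma a := by
  induction n with
  | zero => simp
  | succ n ih =>
    rw [Nat.cast_succ, ← add_assoc, Real.Gamma_add_one (by positivity), ih,
      ascPochhammer_succ_eval]
    ring

theorem lintegral_rpow_mul_exp {p S : ℝ} (hp : 0 < p) (hS : 0 < S) :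
    ∫⁻ t in Set.Ioi 0, ENNReal.ofReal (t ^ (p - 1) * Real.exp (-(S * t))) =
      ENNReal.ofReal (Real.Gamma p * S ^ (-p)) := by
  have integral_eq : ∫ t in Set.Ioi 0, t ^ (p - 1) * Real.exp (-(S * t)) =
      Real.Gamma p * S ^ (-p) := by
    rw [Real.integral_rpow_mul_exp_neg_mul_Ioi hp hS, one_div, Real.inv_rpow hS.le,
      Real.rpow_neg hS.le, mul_comm]
  have integral_ne_zero : Real.Gamma p * S ^ (-p) ≠ 0 :=
    (mul_pos (Real.Gamma_pos_of_pos hp) (Real.rpow_pos_of_pos hS _)).ne'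
  rw [← integral_eq, ofReal_integral_eq_lintegral_ofReal]
  · exact Integrable.of_integral_ne_zero (integral_eq.trans_ne integral_ne_zero)
  · refine (ae_restrict_iff' measurableSet_Ioi).2 (ae_of_all _ fun t ht => ?_)
    exact mul_nonneg (Real.rpow_nonneg (le_of_lt ht) _) (Real.exp_pos _).le

theorem measurable_gammaPDF (a r : ℝ) : Measurable (gammaPDF a r) :=
  (measurable_gammaPDFReal a r).ennreal_ofReal

theorem ae_gammaMeasure_pos (a r : ℝ) : ∀ᵐ x ∂gammaMeasure a r, 0 < x := by
  rw [gammaMeasure, ae_withDensity_iff (measurable_gammaPDF a r)]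
  filter_upwards [Measure.ae_ne volume (0 : ℝ)] with x hx hpdf
  exact hx.lt_or_gt.resolve_left fun h => hpdf (gammaPDF_of_neg h)

theorem lintegral_gammaMeasure_one (a : ℝ) {f : ℝ → ℝ≥0∞} (hf : Measurable f) :
    ∫⁻ x, f x ∂gammaMeasure a 1 = ENNReal.ofReal (1 / Real.Gamma a) *
      ∫⁻ x in Set.Ioi 0, ENNReal.ofReal (x ^ (a - 1) * Real.exp (-x)) * f x := by
  rw [gammaMeasure, lintegral_withDensity_eq_lintegral_mul _ (measurable_gammaPDF a 1) hf,
    ← lintegral_const_mul _ (by fun_prop), ← lintegral_indicator measurableSet_Ioi]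
  refine lintegral_congr_ae ?_
  filter_upwards [Measure.ae_ne volume (0 : ℝ)] with x hx
  rcases hx.lt_or_gt with h | h
  · rw [Set.indicator_of_notMem (by simpa using h.le), Pi.mul_apply, gammaPDF_of_neg h, zero_mul]
  · rw [Set.indicator_of_mem (Set.mem_Ioi.2 h), Pi.mul_apply, gammaPDF_of_nonneg h.le, ← mul_assoc,
      ← ENNReal.ofReal_mul' (by positivity), Real.one_rpow, one_mul, mul_assoc]

theorem lintegral_pow_mul_exp_gammaMeasure {a t : ℝ} (ha : 0 < a) (ht : 0 ≤ t) (n : ℕ) :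
    ∫⁻ x, ENNReal.ofReal x ^ n * ENNReal.ofReal (Real.exp (-(t * x))) ∂gammaMeasure a 1 =
      ENNReal.ofReal ((ascPochhammer ℝ n).eval a * (1 + t) ^ (-(a + n))) := by
  have integrand_eq : ∀ x ∈ Set.Ioi (0 : ℝ), ENNReal.ofReal (x ^ (a - 1) * Real.exp (-x)) *
      (ENNReal.ofReal x ^ n * ENNReal.ofReal (Real.exp (-(t * x)))) =
      ENNReal.ofReal (x ^ (a + n - 1) * Real.exp (-((1 + t) * x))) := by
    intro x (hx : 0 < x)
    rw [← ENNReal.ofReal_pow hx.le, ← ENNReal.ofReal_mul (by positivity),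
      ← ENNReal.ofReal_mul (by positivity)]
    congr 1
    rw [show a + n - 1 = a - 1 + n by ring, Real.rpow_add hx, Real.rpow_natCast,
      show -((1 + t) * x) = -x + -(t * x) by ring, Real.exp_add]
    ring
  have := Real.Gamma_pos_of_pos ha
  rw [lintegral_gammaMeasure_one a (by fun_prop),
    setLIntegral_congr_fun measurableSet_Ioi integrand_eq,
    lintegral_rpow_mul_exp (by positivity) (by positivity), ← ENNReal.ofReal_mul (by positivity),
    gamma_add_natCast ha]
  congr 1
  field_simp

-- Expand `Γ(A + p) (1 + t)^(-(A + p))` as an integral over `s` and integrate over `t` first.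
theorem lintegral_rpow_mul_one_add_rpow {p A : ℝ} (hp : 0 < p) (hA : 0 < A) :
    ∫⁻ t in Set.Ioi 0, ENNReal.ofReal (t ^ (p - 1) * (1 + t) ^ (-(A + p))) =
      ENNReal.ofReal (Real.Gamma p * Real.Gamma A / Real.Gamma (A + p)) := by
  have gamma_pos := Real.Gamma_pos_of_pos (add_pos hA hp)
  have expand : ∀ t ∈ Set.Ioi (0 : ℝ), ENNReal.ofReal (Real.Gamma (A + p)) *
      ENNReal.ofReal (t ^ (p - 1) * (1 + t) ^ (-(A + p))) =
      ∫⁻ s in Set.Ioi 0, ENNReal.ofReal (s ^ (A + p - 1) * Real.exp (-s)) *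
        ENNReal.ofReal (t ^ (p - 1) * Real.exp (-(s * t))) := by
    intro t (ht : 0 < t)
    rw [← ENNReal.ofReal_mul gamma_pos.le, mul_left_comm, ENNReal.ofReal_mul (by positivity),
      ← lintegral_rpow_mul_exp (by positivity) (by positivity),
      ← lintegral_const_mul _ (by fun_prop)]
    refine setLIntegral_congr_fun measurableSet_Ioi fun s (hs : 0 < s) => ?_
    rw [← ENNReal.ofReal_mul (by positivity), ← ENNReal.ofReal_mul (by positivity),
      show -((1 + t) * s) = -s + -(s * t) by ring, Real.exp_add]
    congr 1
    ring
  have integrate_t : ∀ s ∈ Set.Ioi (0 : ℝ), ∫⁻ t in Set.Ioi 0,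
      ENNReal.ofReal (s ^ (A + p - 1) * Real.exp (-s)) *
        ENNReal.ofReal (t ^ (p - 1) * Real.exp (-(s * t))) =
      ENNReal.ofReal (Real.Gamma p) * ENNReal.ofReal (s ^ (A - 1) * Real.exp (-(1 * s))) := by
    intro s (hs : 0 < s)
    rw [lintegral_const_mul _ (by fun_prop), lintegral_rpow_mul_exp hp hs,
      ← ENNReal.ofReal_mul (by positivity), ← ENNReal.ofReal_mul (Real.Gamma_pos_of_pos hp).le,
      show A - 1 = A + p - 1 + -p by ring, Real.rpow_add hs, one_mul]
    congr 1
    ring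
  rw [ENNReal.ofReal_div_of_pos gamma_pos, ENNReal.eq_div_iff (by simpa using gamma_pos)
    ENNReal.ofReal_ne_top, ← lintegral_const_mul _ (by fun_prop),
    setLIntegral_congr_fun measurableSet_Ioi expand, lintegral_lintegral_swap (by fun_prop),
    setLIntegral_congr_fun measurableSet_Ioi integrate_t, lintegral_const_mul _ (by fun_prop),
    lintegral_rpow_mul_exp hA one_pos, Real.one_rpow, mul_one,
    ENNReal.ofReal_mul (Real.Gamma_pos_of_pos hp).le]

theorem measurable_betaPDF (a b : ℝ) : Measurable (betaPDF a b) :=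
  (measurable_betaPDFReal a b).ennreal_ofReal

theorem beta_add_natCast_div_beta {a b : ℝ} (ha : 0 < a) (hb : 0 < b) (m n : ℕ) :
    beta (a + m) (b + n) / beta a b = (ascPochhammer ℝ m).eval a * (ascPochhammer ℝ n).eval b /
      (ascPochhammer ℝ (m + n)).eval (a + b) := by
  have := Real.Gamma_pos_of_pos ha
  have := Real.Gamma_pos_of_pos hb
  have := Real.Gamma_pos_of_pos (add_pos ha hb)
  have pochhammer_pos := ascPochhammer_pos (m + n) (a + b) (add_pos ha hb)
  rw [beta, beta, show a + m + (b + n) = a + b + ((m + n : ℕ) : ℝ) by push_cast; ring,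
    gamma_add_natCast ha, gamma_add_natCast hb, gamma_add_natCast (add_pos ha hb)]
  field_simp

theorem betaPDF_mul_pow_mul_pow {a b : ℝ} (ha : 0 < a) (hb : 0 < b) (m n : ℕ) (x : ℝ) :
    betaPDF a b x * (ENNReal.ofReal x ^ m * ENNReal.ofReal (1 - x) ^ n) =
      ENNReal.ofReal (beta (a + m) (b + n) / beta a b) * betaPDF (a + m) (b + n) x := by
  have beta_pos_left := beta_pos ha hb
  have beta_pos_right : 0 < beta (a + m) (b + n) := beta_pos (by positivity) (by positivity)
  rcases le_or_gt x 0 with h0 | h0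
  · simp [betaPDF_eq_zero_of_nonpos h0]
  rcases le_or_gt 1 x with h1 | h1
  · simp [betaPDF_eq_zero_of_one_le h1]
  have hx : 0 < 1 - x := by linarith
  rw [betaPDF_of_pos_lt_one h0 h1, betaPDF_of_pos_lt_one h0 h1, ← ENNReal.ofReal_pow h0.le,
    ← ENNReal.ofReal_pow hx.le, ← ENNReal.ofReal_mul (by positivity),
    ← ENNReal.ofReal_mul (by positivity), ← ENNReal.ofReal_mul (by positivity)]
  congr 1
  rw [show a + m - 1 = a - 1 + m by ring, show b + n - 1 = b - 1 + n by ring,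
    Real.rpow_add h0, Real.rpow_add hx, Real.rpow_natCast, Real.rpow_natCast]
  field_simp

theorem lintegral_betaMeasure {a b : ℝ} (ha : 0 < a) (hb : 0 < b) (m n : ℕ) :
    ∫⁻ x, ENNReal.ofReal x ^ m * ENNReal.ofReal (1 - x) ^ n ∂betaMeasure a b =
      ENNReal.ofReal ((ascPochhammer ℝ m).eval a * (ascPochhammer ℝ n).eval b /
        (ascPochhammer ℝ (m + n)).eval (a + b)) := by
  rw [betaMeasure, lintegral_withDensity_eq_lintegral_mul _ (measurable_betaPDF a b) (by fun_prop)]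
  simp only [Pi.mul_apply, betaPDF_mul_pow_mul_pow ha hb]
  rw [lintegral_const_mul _ (measurable_betaPDF _ _),
    lintegral_betaPDF_eq_one (by positivity) (by positivity), mul_one,
    beta_add_natCast_div_beta ha hb]

theorem ae_betaMeasure_mem_Ioo (a b : ℝ) : ∀ᵐ x ∂betaMeasure a b, x ∈ Set.Ioo 0 1 := by
  rw [betaMeasure, ae_withDensity_iff (measurable_betaPDF a b)]
  refine ae_of_all _ fun x hx => ⟨?_, ?_⟩ <;> by_contra! h
  · exact hx (betaPDF_eq_zero_of_nonpos h)
  · exact hx (betaPDF_eq_zero_of_one_le h)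

theorem lintegral_pi_prod {K : Type*} [Fintype K] {X : K → Type*} [∀ k, MeasurableSpace (X k)]
    (ν : ∀ k, Measure (X k)) [∀ k, IsProbabilityMeasure (ν k)] {f : ∀ k, X k → ℝ≥0∞}
    (hf : ∀ k, Measurable (f k)) :
    ∫⁻ x, ∏ k, f k (x k) ∂Measure.pi ν = ∏ k, ∫⁻ x, f k x ∂ν k := by
  rw [lintegral_prod_eq_prod_lintegral_of_indepFun Finset.univ (fun k (x : ∀ k, X k) => f k (x k))
    (iIndepFun_pi fun k => (hf k).aemeasurable) fun k => (hf k).comp (measurable_pi_apply k)]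
  exact Finset.prod_congr rfl fun k _ => (measurePreserving_eval ν k).lintegral_comp (hf k)

variable {K : Type*} [Fintype K] {a : K → ℝ}

theorem ae_pi_gammaMeasure_pos (ha : ∀ k, 0 < a k) :
    ∀ᵐ g ∂Measure.pi fun k => gammaMeasure (a k) 1, ∀ k, 0 < g k := by
  have : ∀ k, IsProbabilityMeasure (gammaMeasure (a k) 1) := fun k =>
    isProbabilityMeasure_gammaMeasure (ha k) one_pos
  exact ae_all_iff.2 fun k =>
    (Measure.quasiMeasurePreserving_eval _ k).ae (ae_gammaMeasure_pos (a k) 1)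

theorem ae_dirichletMeasure [Nonempty K] (ha : ∀ k, 0 < a k) :
    ∀ᵐ x ∂dirichletMeasure a, (∀ k, 0 ≤ x k) ∧ ∑ k, x k = 1 := by
  rw [dirichletMeasure, ae_map_iff (by fun_prop) (by measurability)]
  filter_upwards [ae_pi_gammaMeasure_pos ha] with g hg
  have sum_pos : 0 < ∑ j, g j := Finset.sum_pos (fun k _ => hg k) Finset.univ_nonempty
  refine ⟨fun k => div_nonneg (hg k).le sum_pos.le, ?_⟩
  rw [← Finset.sum_div, div_self sum_pos.ne']

theorem lintegral_rpow_mul_prod_pow_mul_exp {g : K → ℝ} (hg : ∀ k, 0 < g k) {r : K → ℕ}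
    (hr : ∑ k, r k ≠ 0) :
    ∫⁻ t in Set.Ioi (0 : ℝ), ENNReal.ofReal (t ^ ((∑ k, r k : ℕ) - 1 : ℝ)) *
        ∏ k, (ENNReal.ofReal (g k) ^ r k * ENNReal.ofReal (Real.exp (-(t * g k)))) =
      ENNReal.ofReal (Real.Gamma (∑ k, r k : ℕ)) * ∏ k, ENNReal.ofReal (g k / ∑ j, g j) ^ r k := by
  obtain ⟨k₀, -, -⟩ := Finset.exists_ne_zero_of_sum_ne_zero hr
  have sum_pos : 0 < ∑ j, g j := Finset.sum_pos (fun k _ => hg k) ⟨k₀, Finset.mem_univ k₀⟩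
  have exponent_pos : (0 : ℝ) < (∑ k, r k : ℕ) := by exact_mod_cast Nat.pos_of_ne_zero hr
  generalize hM : ∑ k, r k = M at *
  have integrand_eq : ∀ t ∈ Set.Ioi (0 : ℝ), ENNReal.ofReal (t ^ ((M : ℝ) - 1)) *
      ∏ k, (ENNReal.ofReal (g k) ^ r k * ENNReal.ofReal (Real.exp (-(t * g k)))) =
      (∏ k, ENNReal.ofReal (g k) ^ r k) *
        ENNReal.ofReal (t ^ ((M : ℝ) - 1) * Real.exp (-((∑ j, g j) * t))) := by
    intro t (ht : 0 < t)
    rw [Finset.prod_mul_distrib, ← ENNReal.ofReal_prod_of_nonneg fun k _ => (Real.exp_pos _).le,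
      ← Real.exp_sum, ENNReal.ofReal_mul (by positivity), Finset.sum_neg_distrib,
      ← Finset.mul_sum, mul_comm t]
    ring
  have normalize_pow : ∀ k, ENNReal.ofReal (g k / ∑ j, g j) ^ r k =
      ENNReal.ofReal (g k) ^ r k * ENNReal.ofReal (∑ j, g j)⁻¹ ^ r k := fun k => by
    rw [div_eq_mul_inv, ENNReal.ofReal_mul (hg k).le, mul_pow]
  simp only [normalize_pow]
  rw [setLIntegral_congr_fun measurableSet_Ioi integrand_eq, lintegral_const_mul _ (by fun_prop),
    lintegral_rpow_mul_exp exponent_pos sum_pos,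
    ENNReal.ofReal_mul (Real.Gamma_pos_of_pos exponent_pos).le, mul_left_comm,
    Finset.prod_mul_distrib, Finset.prod_pow_eq_pow_sum, hM, ← ENNReal.ofReal_pow (by positivity),
    Real.rpow_neg sum_pos.le, Real.rpow_natCast, inv_pow]

theorem lintegral_prod_pow_mul_exp_pi_gammaMeasure (ha : ∀ k, 0 < a k) (r : K → ℕ) {t : ℝ}
    (ht : 0 ≤ t) :
    ∫⁻ g, ∏ k, (ENNReal.ofReal (g k) ^ r k * ENNReal.ofReal (Real.exp (-(t * g k))))
        ∂(Measure.pi fun k => gammaMeasure (a k) 1) =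
      ENNReal.ofReal ((∏ k, (ascPochhammer ℝ (r k)).eval (a k)) *
        (1 + t) ^ (-(∑ k, a k + (∑ k, r k : ℕ)))) := by
  have : ∀ k, IsProbabilityMeasure (gammaMeasure (a k) 1) := fun k =>
    isProbabilityMeasure_gammaMeasure (ha k) one_pos
  rw [lintegral_pi_prod (fun k => gammaMeasure (a k) 1)
    (f := fun k x => ENNReal.ofReal x ^ r k * ENNReal.ofReal (Real.exp (-(t * x)))) (by fun_prop)]
  simp only [lintegral_pow_mul_exp_gammaMeasure (ha _) ht]
  rw [← ENNReal.ofReal_prod_of_nonneg fun k _ =>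
      mul_nonneg (ascPochhammer_pos _ _ (ha k)).le (by positivity),
    Finset.prod_mul_distrib, ← Real.rpow_sum_of_pos (by positivity), Finset.sum_neg_distrib,
    Finset.sum_add_distrib, ← Nat.cast_sum]

-- Write `(∑ g)^(-M)` as an integral of `exp (-t ∑ g)`, which makes the gamma variables separate.
theorem lintegral_dirichletMeasure (ha : ∀ k, 0 < a k) (r : K → ℕ) :
    ∫⁻ x, ∏ k, ENNReal.ofReal (x k) ^ r k ∂dirichletMeasure a =
      ENNReal.ofReal (dirichletMoment a r) := by
  have : ∀ k, IsProbabilityMeasure (gammaMeasure (a k) 1) := fun k =>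
    isProbabilityMeasure_gammaMeasure (ha k) one_pos
  rw [dirichletMeasure, lintegral_map (by fun_prop) (by fun_prop)]
  rcases eq_or_ne (∑ k, r k) 0 with hr | hr
  · have r_eq_zero : ∀ k, r k = 0 := by simpa using hr
    simp [dirichletMoment, r_eq_zero]
  obtain ⟨k₀, -, -⟩ := Finset.exists_ne_zero_of_sum_ne_zero hr
  have param_pos : 0 < ∑ k, a k := Finset.sum_pos (fun k _ => ha k) ⟨k₀, Finset.mem_univ k₀⟩
  have exponent_pos : (0 : ℝ) < (∑ k, r k : ℕ) := by exact_mod_cast Nat.pos_of_ne_zero hr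
  have gamma_pos := Real.Gamma_pos_of_pos exponent_pos
  have prod_nonneg : 0 ≤ ∏ k, (ascPochhammer ℝ (r k)).eval (a k) :=
    Finset.prod_nonneg fun k _ => (ascPochhammer_pos _ _ (ha k)).le
  have integrate_g : ∀ t ∈ Set.Ioi (0 : ℝ), ∫⁻ g, ENNReal.ofReal (t ^ ((∑ k, r k : ℕ) - 1 : ℝ)) *
        ∏ k, (ENNReal.ofReal (g k) ^ r k * ENNReal.ofReal (Real.exp (-(t * g k))))
        ∂(Measure.pi fun k => gammaMeasure (a k) 1) =
      ENNReal.ofReal (∏ k, (ascPochhammer ℝ (r k)).eval (a k)) *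
        ENNReal.ofReal (t ^ ((∑ k, r k : ℕ) - 1 : ℝ) *
          (1 + t) ^ (-(∑ k, a k + (∑ k, r k : ℕ)))) := by
    intro t (ht : 0 < t)
    rw [lintegral_const_mul _ (by fun_prop),
      lintegral_prod_pow_mul_exp_pi_gammaMeasure ha r ht.le, ← ENNReal.ofReal_mul (by positivity),
      ← ENNReal.ofReal_mul prod_nonneg, mul_left_comm]
  refine (ENNReal.mul_right_inj (a := ENNReal.ofReal (Real.Gamma (∑ k, r k : ℕ)))
    (by simpa using gamma_pos) ENNReal.ofReal_ne_top).1 ?_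
  rw [← lintegral_const_mul _ (by fun_prop),
    ← lintegral_congr_ae ((ae_pi_gammaMeasure_pos ha).mono fun g hg =>
      lintegral_rpow_mul_prod_pow_mul_exp hg hr),
    lintegral_lintegral_swap (by fun_prop), setLIntegral_congr_fun measurableSet_Ioi integrate_g,
    lintegral_const_mul _ (by fun_prop), lintegral_rpow_mul_one_add_rpow exponent_pos param_pos,
    gamma_add_natCast param_pos, ← ENNReal.ofReal_mul gamma_pos.le,
    ← ENNReal.ofReal_mul prod_nonneg,
    mul_div_mul_right _ _ (Real.Gamma_pos_of_pos param_pos).ne', dirichletMoment,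
    mul_div_left_comm]

end GammaBetaDirichlet

section Schemes

variable {Ω : Type*} {mΩ : MeasurableSpace Ω} {μ : Measure Ω} {α : ℝ}

theorem isSplittingScheme_of_dirichlet {ι : Type*} [Fintype ι] (hα1 : α < 1) {τ : List ι → ℝ}
    (hτ0 : ∀ w, 0 < τ w) (hτ : ∀ w, ∑ i, τ (i :: w) = τ w + α)
    {D : List ι → Ω → Option ι → ℝ} (hDmeas : ∀ w, Measurable (D w))
    (hDlaw : ∀ w, μ.map (D w) = dirichletMeasure (splitParam α fun i => τ (i :: w)))
    (hDindep : iIndepFun D μ) : IsSplittingScheme μ α τ D := by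
  have param_pos : ∀ w k, 0 < splitParam α (fun i => τ (i :: w)) k := fun w =>
    splitParam_pos hα1 fun i => hτ0 _
  have ae_simplex : ∀ w, ∀ᵐ ω ∂μ, (∀ k, 0 ≤ D w ω k) ∧ ∑ k, D w ω k = 1 := fun w =>
    ae_of_ae_map (hDmeas w).aemeasurable (hDlaw w ▸ ae_dirichletMeasure (param_pos w))
  exact {
    measurable := hDmeas
    indep := hDindep
    nonneg := fun w => (ae_simplex w).mono fun _ h => h.1
    sum_eq_one := fun w => (ae_simplex w).mono fun _ h => h.2
    moment := fun w r => by
      rw [← lintegral_dirichletMeasure (param_pos w), ← hDlaw w,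
        lintegral_map (by fun_prop) (hDmeas w)]
    pos := hτ0
    sum_param := hτ }

/-- The splitting scheme of stick-breaking: every crumb has a single crumb child, which keeps the
fraction `W`, and the rest is broken off as a solid. -/
def stickSplitting (W : ℕ → Ω → ℝ) (v : List Unit) (ω : Ω) : Option Unit → ℝ
  | some _ => W v.length ω
  | none => 1 - W v.length ω

theorem crumbSize_stickSplitting (W : ℕ → Ω → ℝ) (ω : Ω) (w : List Unit) :
    crumbSize (fun v => stickSplitting W v ω) w = ∏ i ∈ Finset.range w.length, W i ω := by
  induction w with
  | nil => rfl
  | cons i w ih =>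
    rw [crumbSize, ih, List.length_cons, Finset.prod_range_succ]
    rfl

theorem solidSize_stickSplitting (W : ℕ → Ω → ℝ) (ω : Ω) (w : List Unit) :
    solidSize (fun v => stickSplitting W v ω) w =
      (∏ i ∈ Finset.range w.length, W i ω) * (1 - W w.length ω) := by
  rw [solidSize, crumbSize_stickSplitting]
  rfl

theorem length_injective_of_unit : Function.Injective (List.length : List Unit → ℕ) :=
  fun _ _ h => List.ext_getElem h fun _ _ _ => rfl

theorem lintegral_prod_stickSplitting {W : ℕ → Ω → ℝ} (hWmeas : ∀ j, Measurable (W j))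
    (v : List Unit) {a b : ℝ} (ha : 0 < a) (hb : 0 < b)
    (hWlaw : μ.map (W v.length) = betaMeasure a b) (r : Option Unit → ℕ) :
    ∫⁻ ω, ∏ k, ENNReal.ofReal (stickSplitting W v ω k) ^ r k ∂μ =
      ENNReal.ofReal ((ascPochhammer ℝ (r (some ()))).eval a * (ascPochhammer ℝ (r none)).eval b /
        (ascPochhammer ℝ (r (some ()) + r none)).eval (a + b)) := by
  rw [← lintegral_betaMeasure ha hb, ← hWlaw, lintegral_map (by fun_prop) (hWmeas _)]
  simp [Fintype.prod_option, stickSplitting, mul_comm]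

theorem dirichletMoment_splitParam_unit (a : ℝ) (r : Option Unit → ℕ) :
    dirichletMoment (splitParam α fun _ : Unit => a) r =
      (ascPochhammer ℝ (r (some ()))).eval a * (ascPochhammer ℝ (r none)).eval (1 - α) /
        (ascPochhammer ℝ (r (some ()) + r none)).eval (a + (1 - α)) := by
  simp [dirichletMoment, splitParam, Fintype.prod_option, Fintype.sum_option, mul_comm,
    add_comm (r none), add_comm (1 - α)]

theorem isSplittingScheme_stickSplitting {θ : ℝ} (hα0 : 0 ≤ α) (hα1 : α < 1) (hθ : 0 < θ)
    {W : ℕ → Ω → ℝ} (hWmeas : ∀ j, Measurable (W j)) (hW : iIndepFun W μ)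
    (hWlaw : ∀ j : ℕ, μ.map (W j) = betaMeasure (θ + (j + 1) * α) (1 - α)) :
    IsSplittingScheme μ α (fun v : List Unit => θ + v.length * α) (stickSplitting W) := by
  let split : ℝ → Option Unit → ℝ := fun x k => k.elim (1 - x) fun _ => x
  have measurable_split : Measurable split := measurable_pi_iff.2 fun k => by
    rcases k with _ | _
    · exact measurable_const.sub measurable_id
    · exact measurable_id
  have stickSplitting_eq : stickSplitting W = fun v => split ∘ W v.length := by
    funext v ω k
    rcases k with _ | _ <;> rfl
  have ae_mem_Ioo : ∀ j, ∀ᵐ ω ∂μ, W j ω ∈ Set.Ioo 0 1 := fun j =>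
    ae_of_ae_map (hWmeas j).aemeasurable (hWlaw j ▸ ae_betaMeasure_mem_Ioo _ _)
  exact {
    measurable := fun v => stickSplitting_eq ▸ measurable_split.comp (hWmeas _)
    indep := stickSplitting_eq ▸
      (hW.precomp length_injective_of_unit).comp (fun _ => split) fun _ => measurable_split
    nonneg := fun v => (ae_mem_Ioo v.length).mono fun ω hω k => by
      rcases k with _ | _
      exacts [sub_nonneg.2 hω.2.le, hω.1.le]
    sum_eq_one := fun v => ae_of_all _ fun ω => by simp [Fintype.sum_option, stickSplitting]
    moment := fun v r => by
      simp only [List.length_cons, Nat.cast_add_one]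
      rw [lintegral_prod_stickSplitting hWmeas v (by positivity) (sub_pos.2 hα1) (hWlaw _),
        dirichletMoment_splitParam_unit]
    pos := fun v => by positivity
    sum_param := fun v => by
      simp only [Finset.univ_unique, Finset.sum_singleton, List.length_cons, Nat.cast_add_one]
      ring }

end Schemes

section Partitions

/-- The restriction of a partition of `ℕ` to the first `n` balls. -/
def restrictFin (n : ℕ) (s : Setoid ℕ) : Setoid (Fin n) := s.comap Fin.val

/-- The size of a block of a partition. -/
noncomputable def blockSize {X : Type*} {π : Setoid X} (q : Quotient π) : ℕ :=
  Nat.card {x : X // (⟦x⟧ : Quotient π) = q}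

theorem blockSize_ne_zero {X : Type*} [Finite X] {π : Setoid X} (q : Quotient π) :
    blockSize q ≠ 0 := by
  obtain ⟨x, rfl⟩ := Quotient.exists_rep q
  have : Nonempty {y : X // (⟦y⟧ : Quotient π) = ⟦x⟧} := ⟨⟨x, rfl⟩⟩
  exact Nat.card_pos.ne'

theorem sum_blockSize {X : Type*} [Finite X] (π : Setoid X) [Fintype (Quotient π)] :
    ∑ q : Quotient π, blockSize q = Nat.card X := by
  rw [← Nat.card_congr (Equiv.sigmaFiberEquiv (Quotient.mk π)), Nat.card_sigma]
  rfl

theorem prod_mk_eq_prod_pow_blockSize {X M : Type*} [Fintype X] [CommMonoid M] (π : Setoid X)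
    [Fintype (Quotient π)] (g : Quotient π → M) :
    ∏ x, g ⟦x⟧ = ∏ q, g q ^ blockSize q := by
  classical
  rw [← Fintype.prod_fiberwise' (Quotient.mk π) g]
  refine Finset.prod_congr rfl fun q _ => ?_
  rw [Finset.prod_const, Finset.card_univ, ← Nat.card_eq_fintype_card]
  rfl

theorem finite_setoid (X : Type*) [Finite X] : Finite (Setoid X) :=
  Finite.of_injective (fun (s : Setoid X) a b => s a b) fun _ _ h =>
    Setoid.ext fun a b => iff_of_eq (congrFun (congrFun h a) b)

theorem measurableSet_rel (a b : ℕ) : MeasurableSet {s : Setoid ℕ | s a b} := by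
  have h : Measurable fun s : Setoid ℕ => fun m n => s.r m n := comap_measurable _
  exact measurableSet_setOfPred.2 ((measurable_pi_apply b).comp ((measurable_pi_apply a).comp h))

theorem measurableSet_restrictFin_eq {n : ℕ} (π : Setoid (Fin n)) :
    MeasurableSet {s : Setoid ℕ | restrictFin n s = π} := by
  have eq_iInter : {s : Setoid ℕ | restrictFin n s = π} =
      ⋂ a : Fin n, ⋂ b : Fin n, {s : Setoid ℕ | s a b ↔ π a b} := by
    ext s
    simp only [Set.mem_ofPred_eq, Set.mem_iInter]
    exact ⟨fun h a b => by rw [← h]; rfl, fun h => Setoid.ext h⟩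
  rw [eq_iInter]
  refine MeasurableSet.iInter fun a => MeasurableSet.iInter fun b => ?_
  by_cases hab : π a b
  · simpa only [hab, iff_true] using measurableSet_rel a b
  · simpa only [hab, iff_false, Set.compl_ofPred] using (measurableSet_rel a b).compl

theorem restrictFin_eq_of_le {n N : ℕ} (hnN : n ≤ N) {s t : Setoid ℕ}
    (h : restrictFin N s = restrictFin N t) : restrictFin n s = restrictFin n t :=
  congrArg (Setoid.comap (Fin.castLE hnN)) h

theorem isPiSystem_restrictFin_eq :
    IsPiSystem {S : Set (Setoid ℕ) | ∃ n, ∃ π : Setoid (Fin n), S = {s | restrictFin n s = π}} := by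
  rintro _ ⟨n, _, rfl⟩ _ ⟨n', _, rfl⟩ ⟨s, rfl, rfl⟩
  rcases le_total n n' with h | h
  · exact ⟨n', _, Set.inter_eq_right.2 fun t ht => restrictFin_eq_of_le h ht⟩
  · exact ⟨n, _, Set.inter_eq_left.2 fun t ht => restrictFin_eq_of_le h ht⟩

theorem generateFrom_restrictFin_eq : instMeasurableSpaceSetoidNat = MeasurableSpace.generateFrom
    {S | ∃ n, ∃ π : Setoid (Fin n), S = {s | restrictFin n s = π}} := by
  refine le_antisymm ?_ (MeasurableSpace.generateFrom_le ?_)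
  · refine measurable_iff_comap_le.1 ?_
    refine @measurable_pi_lambda _ _ _ (MeasurableSpace.generateFrom _) _ _ fun a => ?_
    refine @measurable_pi_lambda _ _ _ (MeasurableSpace.generateFrom _) _ _ fun b => ?_
    refine (@measurableSet_setOfPred _ (MeasurableSpace.generateFrom _) _).1 ?_
    let N := max a b + 1
    have := finite_setoid (Fin N)
    have rel_eq_iUnion : {s : Setoid ℕ | s a b} =
        ⋃ π ∈ {π : Setoid (Fin N) | π ⟨a, by omega⟩ ⟨b, by omega⟩},
          {s : Setoid ℕ | restrictFin N s = π} := by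
      ext s
      simp only [Set.mem_iUnion, Set.mem_ofPred_eq, exists_prop, exists_eq_right']
      rfl
    change MeasurableSet[MeasurableSpace.generateFrom _] {s : Setoid ℕ | s a b}
    rw [rel_eq_iUnion]
    exact MeasurableSet.biUnion (Set.to_countable _) fun π _ =>
      MeasurableSpace.measurableSet_generateFrom ⟨N, π, rfl⟩
  · rintro _ ⟨n, π, rfl⟩
    exact measurableSet_restrictFin_eq π

theorem ext_of_restrictFin {ρ ρ' : Measure (Setoid ℕ)} [IsProbabilityMeasure ρ]
    [IsProbabilityMeasure ρ']
    (h : ∀ n (π : Setoid (Fin n)), ρ {s | restrictFin n s = π} = ρ' {s | restrictFin n s = π}) :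
    ρ = ρ' := by
  refine ext_of_generate_finite _ generateFrom_restrictFin_eq isPiSystem_restrictFin_eq ?_
    (by simp only [measure_univ])
  rintro _ ⟨n, π, rfl⟩
  exact h n π

end Partitions

section ColorPartition

variable {Ω J : Type*} {mΩ : MeasurableSpace Ω} {μ : Measure Ω} {C : ℕ → Ω → J}

theorem restrictFin_colorPartition_eq_iff (C : ℕ → Ω → J) (ω : Ω) {n : ℕ} (π : Setoid (Fin n)) :
    restrictFin n (colorPartition C ω) = π ↔
      ∃ c : Quotient π ↪ J, ∀ k : Fin n, C k ω = c ⟦k⟧ := by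
  constructor
  · intro h
    have rel_iff : ∀ a b : Fin n, π a b ↔ C a ω = C b ω := fun a b => by rw [← h]; rfl
    refine ⟨⟨Quotient.lift (fun k : Fin n => C k ω) fun a b hab => (rel_iff a b).1 hab, ?_⟩,
      fun k => rfl⟩
    rintro ⟨a⟩ ⟨b⟩ hab
    exact Quotient.sound ((rel_iff a b).2 hab)
  · rintro ⟨c, hc⟩
    ext a b
    change C a ω = C b ω ↔ _
    rw [hc, hc, c.injective.eq_iff, Quotient.eq]

theorem disjoint_setOf_color_eq {X : Type*} {π : Setoid X} {C : X → Ω → J} {c c' : Quotient π ↪ J}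
    (hcc' : c ≠ c') : Disjoint {ω | ∀ x, C x ω = c ⟦x⟧} {ω | ∀ x, C x ω = c' ⟦x⟧} := by
  rw [Set.disjoint_left]
  intro ω h h'
  refine hcc' (DFunLike.ext _ _ fun q => ?_)
  obtain ⟨x, rfl⟩ := Quotient.exists_rep q
  exact (h x).symm.trans (h' x)

theorem measure_forall_color_eq {P : J → Ω → ℝ} (hC : IsPaintboxSample μ P C) {n : ℕ}
    (π : Setoid (Fin n)) [Fintype (Quotient π)] (c : Quotient π ↪ J) :
    μ {ω | ∀ k : Fin n, C k ω = c ⟦k⟧} =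
      ∫⁻ ω, ∏ q, ENNReal.ofReal (P (c q) ω) ^ blockSize q ∂μ := by
  have sample := hC.2 n (fun k => c ⟦k⟧) Set.univ MeasurableSet.univ
  simp only [Set.mem_univ, true_and, Set.ofPred_true, Measure.restrict_univ] at sample
  rw [sample]
  exact lintegral_congr fun ω =>
    prod_mk_eq_prod_pow_blockSize π fun q => ENNReal.ofReal (P (c q) ω)

variable [Countable J]

theorem measure_restrictFin_colorPartition {P : J → Ω → ℝ} (hP : ∀ j, Measurable (P j))
    (hC : IsPaintboxSample μ P C) {n : ℕ} (π : Setoid (Fin n)) [Fintype (Quotient π)] :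
    μ {ω | restrictFin n (colorPartition C ω) = π} =
      ∫⁻ ω, paintboxEPPF (fun j => ENNReal.ofReal (P j ω)) (blockSize (π := π)) ∂μ := by
  have : Countable (Quotient π ↪ J) := DFunLike.coe_injective.countable
  have eq_iUnion : {ω | restrictFin n (colorPartition C ω) = π} =
      ⋃ c : Quotient π ↪ J, {ω | ∀ k : Fin n, C k ω = c ⟦k⟧} := by
    ext ω
    simp only [restrictFin_colorPartition_eq_iff, Set.mem_iUnion, Set.mem_ofPred_eq]
  have measurable_color : ∀ c : Quotient π ↪ J,
      MeasurableSet {ω | ∀ k : Fin n, C k ω = c ⟦k⟧} := fun c => by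
    rw [Set.ofPred_forall]
    exact MeasurableSet.iInter fun k => hC.1 _ _
  unfold paintboxEPPF
  rw [eq_iUnion, measure_iUnion (fun c c' hcc' => disjoint_setOf_color_eq hcc') measurable_color,
    lintegral_tsum fun c => (Finset.measurable_prod _ fun q _ =>
      (hP (c q)).ennreal_ofReal.pow_const _).aemeasurable]
  exact tsum_congr (measure_forall_color_eq hC π)

theorem measurable_colorPartition (hC : ∀ n j, MeasurableSet {ω | C n ω = j}) :
    Measurable (colorPartition C) := by
  refine measurable_comap_iff.2 (measurable_pi_iff.2 fun a => measurable_pi_iff.2 fun b => ?_)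
  have same_color : {ω | C a ω = C b ω} = ⋃ j, ({ω | C a ω = j} ∩ {ω | C b ω = j}) := by
    ext ω
    simp [eq_comm]
  refine measurableSet_setOfPred.1 ?_
  change MeasurableSet {ω | C a ω = C b ω}
  rw [same_color]
  exact MeasurableSet.iUnion fun j => (hC a j).inter (hC b j)

end ColorPartition

section Counting

theorem exists_equiv_comp_eq {X Y R : Type*} [Finite X] [Finite Y] (u : X → R) (v : Y → R)
    (h : ∀ r, Nat.card {x // u x = r} = Nat.card {y // v y = r}) : ∃ e : X ≃ Y, v ∘ e = u := by
  let e : ∀ r, {x // u x = r} ≃ {y // v y = r} := fun r => (Finite.card_eq.1 (h r)).some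
  refine ⟨(Equiv.sigmaFiberEquiv u).symm.trans ((Equiv.sigmaCongrRight e).trans
    (Equiv.sigmaFiberEquiv v)), funext fun x => ?_⟩
  exact (e (u x) ⟨x, rfl⟩).2

theorem card_perm_comp_eq {X R : Type*} [Finite X] (u : X → R) {s : Finset R}
    (hs : ∀ x, u x ∈ s) :
    Nat.card {g : Equiv.Perm X // u ∘ g = u} = ∏ r ∈ s, (Nat.card {x // u x = r}).factorial := by
  classical
  have := Fintype.ofFinite X
  simp only [Nat.card_eq_fintype_card]
  rw [DomMulAct.stabilizer_card']
  refine Finset.prod_subset (Finset.image_subset_iff.2 fun x _ => hs x) fun r _ hr => ?_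
  have : IsEmpty {x // u x = r} :=
    ⟨fun x => hr (Finset.mem_image.2 ⟨x.1, Finset.mem_univ _, x.2⟩)⟩
  rw [Fintype.card_eq_zero, Nat.factorial_zero]

theorem card_equiv_comp_eq {X Y R : Type*} [Finite X] [Finite Y] (u : X → R) (v : Y → R)
    (h : ∀ r, Nat.card {x // u x = r} = Nat.card {y // v y = r}) {s : Finset R}
    (hs : ∀ x, u x ∈ s) :
    Nat.card {e : X ≃ Y // v ∘ e = u} = ∏ r ∈ s, (Nat.card {x // u x = r}).factorial := by
  obtain ⟨e₀, rfl⟩ := exists_equiv_comp_eq u v h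
  rw [← card_perm_comp_eq _ hs]
  refine Nat.card_congr (((Equiv.refl X).equivCongr e₀.symm).subtypeEquiv fun e => ?_)
  simp [funext_iff]

theorem card_eq_card_mul_of_card_fiber {A F : Type*} [Finite A] [Finite F] (Φ : A → F) {c : ℕ}
    (hc : ∀ f, Nat.card {a // Φ a = f} = c) : Nat.card A = Nat.card F * c := by
  have := Fintype.ofFinite F
  rw [← Nat.card_congr (Equiv.sigmaFiberEquiv Φ), Nat.card_sigma,
    Finset.sum_congr rfl fun f _ => hc f, Finset.sum_const, smul_eq_mul,
    Finset.card_univ, Nat.card_eq_fintype_card]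

theorem card_sigmaFst_fiber {B : Type*} (m : B → ℕ) (b : B) :
    Nat.card {p : Σ b, Fin (m b) // p.1 = b} = m b := by
  rw [Nat.card_congr (Equiv.sigmaSubtype b), Nat.card_fin]

theorem card_prescribed_fiber_mul {X B : Type*} [Finite X] [Fintype B] {m : B → ℕ}
    (hm : ∑ b, m b = Nat.card X) :
    Nat.card {f : X → B // ∀ b, Nat.card {x // f x = b} = m b} * ∏ b, (m b).factorial =
      (Nat.card X).factorial := by
  classical
  have := Fintype.ofFinite X
  have e₀ : X ≃ Σ b, Fin (m b) := (Finite.card_eq.1 (by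
    rw [← hm, Nat.card_sigma]
    simp only [Nat.card_fin])).some
  let Φ : (X ≃ Σ b, Fin (m b)) → {f : X → B // ∀ b, Nat.card {x // f x = b} = m b} := fun e =>
    ⟨fun x => (e x).1, fun b => (Nat.card_congr (e.subtypeEquiv fun _ => Iff.rfl)).trans
      (card_sigmaFst_fiber m b)⟩
  have card_fiber : ∀ f, Nat.card {e // Φ e = f} = ∏ b, (m b).factorial := fun f => by
    rw [Nat.card_congr (Equiv.subtypeEquivRight fun _ => Subtype.ext_iff)]
    refine (card_equiv_comp_eq f.1 Sigma.fst (fun b => ?_) fun _ => Finset.mem_univ _).trans ?_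
    · rw [f.2, card_sigmaFst_fiber]
    · simp only [f.2]
  rw [← card_eq_card_mul_of_card_fiber Φ card_fiber, Nat.card_eq_fintype_card,
    Fintype.card_equiv e₀, Nat.card_eq_fintype_card]

theorem card_fiber_eq_blockSize {X B : Type*} {π : Setoid X} (e : Quotient π ≃ B) (b : B) :
    Nat.card {x : X // e ⟦x⟧ = b} = blockSize (e.symm b) :=
  Nat.card_congr (Equiv.subtypeEquivRight fun _ => (Equiv.eq_symm_apply e).symm)

/-- The block sizes of `π` are the `m b`, up to order. -/
def HasBlockSizes {X B : Type*} (m : B → ℕ) (π : Setoid X) : Prop :=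
  ∀ r, Nat.card {q : Quotient π // blockSize q = r} = Nat.card {b // m b = r}

theorem hasBlockSizes_of_equiv {X B : Type*} {m : B → ℕ} {π : Setoid X} (e : Quotient π ≃ B)
    (he : m ∘ e = blockSize) : HasBlockSizes m π := fun r =>
  Nat.card_congr (e.subtypeEquiv fun q => by rw [← he]; rfl)

theorem surjective_of_card_fiber {X B : Type*} {m : B → ℕ} (hm0 : ∀ b, m b ≠ 0) {f : X → B}
    (hf : ∀ b, Nat.card {x // f x = b} = m b) : Function.Surjective f := fun b => by
  obtain ⟨⟨x, hx⟩⟩ := (Nat.card_ne_zero.1 ((hf b).trans_ne (hm0 b))).1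
  exact ⟨x, hx⟩

theorem comp_quotientKerEquivOfSurjective_eq_blockSize {X B : Type*} {m : B → ℕ} {f : X → B}
    (hf : ∀ b, Nat.card {x // f x = b} = m b) (hsurj : Function.Surjective f) :
    m ∘ Setoid.quotientKerEquivOfSurjective f hsurj = blockSize := by
  let e := Setoid.quotientKerEquivOfSurjective f hsurj
  funext q
  change m (e q) = _
  rw [← hf, ← e.symm_apply_apply q, ← card_fiber_eq_blockSize, e.symm_apply_apply]
  rfl

theorem card_prescribed_fiber_ker_eq {X B : Type*} {m : B → ℕ}
    (hm0 : ∀ b, m b ≠ 0) (π : Setoid X) :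
    Nat.card {f : {f : X → B // ∀ b, Nat.card {x // f x = b} = m b} // Setoid.ker f.1 = π} =
      Nat.card {e : Quotient π ≃ B // m ∘ e = blockSize} := by
  symm
  refine Nat.card_congr (Equiv.ofBijective (fun e => ⟨⟨fun x => e.1 ⟦x⟧, fun b => ?_⟩, ?_⟩)
    ⟨fun e e' h => ?_, ?_⟩)
  · exact (card_fiber_eq_blockSize e.1 b).trans
      ((congrFun e.2 _).symm.trans (congrArg m (e.1.apply_symm_apply b)))
  · ext x y
    rw [Setoid.ker_def, e.1.apply_eq_iff_eq, Quotient.eq]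
  · refine Subtype.ext (Equiv.ext fun q => ?_)
    obtain ⟨x, rfl⟩ := Quotient.exists_rep q
    exact congrFun (congrArg Subtype.val (congrArg Subtype.val h)) x
  · rintro ⟨⟨f, hf⟩, rfl⟩
    have hsurj := surjective_of_card_fiber hm0 hf
    exact ⟨⟨Setoid.quotientKerEquivOfSurjective f hsurj,
      comp_quotientKerEquivOfSurjective_eq_blockSize hf hsurj⟩, rfl⟩

theorem card_hasBlockSizes_mul {X B : Type*} [Finite X] [Fintype B] {m : B → ℕ}
    (hm0 : ∀ b, m b ≠ 0) (hm : ∑ b, m b = Nat.card X) {s : Finset ℕ} (hs : ∀ b, m b ∈ s) :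
    Nat.card {π : Setoid X // HasBlockSizes m π} *
      ((∏ r ∈ s, (Nat.card {b // m b = r}).factorial) * ∏ b, (m b).factorial) =
      (Nat.card X).factorial := by
  have := finite_setoid X
  let F := {f : X → B // ∀ b, Nat.card {x // f x = b} = m b}
  let Φ : F → {π : Setoid X // HasBlockSizes m π} := fun f => ⟨Setoid.ker f.1,
    hasBlockSizes_of_equiv _ (comp_quotientKerEquivOfSurjective_eq_blockSize f.2
      (surjective_of_card_fiber hm0 f.2))⟩
  have card_fiber : ∀ π, Nat.card {f // Φ f = π} =
      ∏ r ∈ s, (Nat.card {b // m b = r}).factorial := fun π => by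
    rw [Nat.card_congr (Equiv.subtypeEquivRight fun _ => Subtype.ext_iff),
      card_prescribed_fiber_ker_eq hm0]
    have hex := exists_equiv_comp_eq _ _ π.2
    refine (card_equiv_comp_eq _ _ π.2 fun q => ?_).trans (Finset.prod_congr rfl fun r _ => ?_)
    · obtain ⟨e, he⟩ := hex
      exact congrFun he q ▸ hs (e q)
    · rw [π.2]
  rw [← mul_assoc, ← card_eq_card_mul_of_card_fiber Φ card_fiber, card_prescribed_fiber_mul hm]

/-- The partitions with `k r` blocks of size `r`, for each `r = 1, …, n`. -/
def HasBlockCounts {n : ℕ} (k : ℕ → ℕ) (π : Setoid (Fin n)) : Prop :=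
  ∀ r ∈ Finset.Icc 1 n, Nat.card {q : Quotient π // blockSize q = r} = k r

theorem blockSize_mem_Icc {n : ℕ} {π : Setoid (Fin n)} (q : Quotient π) :
    blockSize q ∈ Finset.Icc 1 n :=
  Finset.mem_Icc.2 ⟨Nat.one_le_iff_ne_zero.2 (blockSize_ne_zero q),
    (Finite.card_subtype_le _).trans_eq (Nat.card_fin n)⟩

/-- The block sizes prescribed by the block counts `k`: `k r` times the size `r`. -/
def sizesOfCounts (n : ℕ) (k : ℕ → ℕ) (b : Σ r : Finset.Icc 1 n, Fin (k r)) : ℕ := b.1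

theorem card_sizesOfCounts_eq {n : ℕ} (k : ℕ → ℕ) {r : ℕ} (hr : r ∈ Finset.Icc 1 n) :
    Nat.card {b // sizesOfCounts n k b = r} = k r := by
  rw [← card_sigmaFst_fiber (fun r : Finset.Icc 1 n => k r) ⟨r, hr⟩]
  exact Nat.card_congr (Equiv.subtypeEquivRight fun b => by rw [Subtype.ext_iff]; rfl)

theorem hasBlockSizes_sizesOfCounts_iff {n : ℕ} {k : ℕ → ℕ} {π : Setoid (Fin n)} :
    HasBlockSizes (sizesOfCounts n k) π ↔ HasBlockCounts k π := by
  refine ⟨fun h r hr => (h r).trans (card_sizesOfCounts_eq k hr), fun h r => ?_⟩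
  by_cases hr : r ∈ Finset.Icc 1 n
  · exact (h r hr).trans (card_sizesOfCounts_eq k hr).symm
  · have : IsEmpty {q : Quotient π // blockSize q = r} := ⟨fun q => hr (q.2 ▸ blockSize_mem_Icc _)⟩
    have : IsEmpty {b // sizesOfCounts n k b = r} := ⟨fun b => hr (b.2 ▸ b.1.1.2)⟩
    rw [Nat.card_of_isEmpty, Nat.card_of_isEmpty]

theorem card_hasBlockCounts_mul {n : ℕ} (k : ℕ → ℕ) (hk : ∑ r ∈ Finset.Icc 1 n, r * k r = n) :
    Nat.card {π : Setoid (Fin n) // HasBlockCounts k π} *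
      ∏ r ∈ Finset.Icc 1 n, (r.factorial ^ k r * (k r).factorial) = n.factorial := by
  have sum_sizes : ∑ b, sizesOfCounts n k b = Nat.card (Fin n) := by
    rw [Fintype.sum_sigma, Nat.card_fin]
    simp only [sizesOfCounts, Finset.sum_const, Finset.card_univ, Fintype.card_fin, smul_eq_mul]
    rw [Finset.sum_coe_sort (Finset.Icc 1 n) fun r => k r * r]
    simpa only [mul_comm] using hk
  have prod_sizes : ∏ b, (sizesOfCounts n k b).factorial =
      ∏ r ∈ Finset.Icc 1 n, r.factorial ^ k r := by
    rw [Fintype.prod_sigma, ← Finset.prod_coe_sort (Finset.Icc 1 n) fun r => r.factorial ^ k r]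
    simp [sizesOfCounts]
  have h := card_hasBlockSizes_mul (m := sizesOfCounts n k) (s := Finset.Icc 1 n)
    (fun b => Nat.one_le_iff_ne_zero.1 (Finset.mem_Icc.1 b.1.2).1) sum_sizes fun b => b.1.2
  rw [prod_sizes, Finset.prod_congr rfl fun r hr => by rw [card_sizesOfCounts_eq k hr],
    ← Finset.prod_mul_distrib, Nat.card_fin] at h
  simpa only [hasBlockSizes_sizesOfCounts_iff, mul_comm] using h

end Counting

section SamplingFormula

theorem blockCount_eq_card (s : Setoid ℕ) (n r : ℕ) :
    blockCount s n r = Nat.card {q : Quotient (restrictFin n s) // blockSize q = r} := by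
  unfold blockCount
  rw [← Nat.card_coe_set_eq]
  let e : Quotient (restrictFin n s) ≃ (restrictFin n s).classes :=
    Setoid.quotientEquivClasses (restrictFin n s)
  have blockSize_eq : ∀ q, blockSize q = (e q : Set (Fin n)).ncard := fun q => by
    obtain ⟨x, rfl⟩ := Quotient.exists_rep q
    rw [blockSize, ← Nat.card_coe_set_eq]
    exact Nat.card_congr (Equiv.subtypeEquivRight fun y => Quotient.eq)
  refine (Nat.card_congr ((e.subtypeEquiv
    (q := fun B : (restrictFin n s).classes => (B : Set (Fin n)).ncard = r)
    fun q => by rw [blockSize_eq]).trans ?_)).symm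
  exact Equiv.subtypeSubtypeEquivSubtypeInter (fun B => B ∈ (restrictFin n s).classes)
    fun B => B.ncard = r

theorem hasBlockCounts_restrictFin_iff (s : Setoid ℕ) (n : ℕ) (k : ℕ → ℕ) :
    HasBlockCounts k (restrictFin n s) ↔ ∀ r ∈ Finset.Icc 1 n, blockCount s n r = k r := by
  simp only [HasBlockCounts, blockCount_eq_card]

namespace HasBlockCounts

variable {n : ℕ} {k : ℕ → ℕ} {π : Setoid (Fin n)} [Fintype (Quotient π)]

theorem card_filter (hπ : HasBlockCounts k π) {r : ℕ} (hr : r ∈ Finset.Icc 1 n) :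
    (Finset.univ.filter fun q : Quotient π => blockSize q = r).card = k r := by
  rw [← hπ r hr, Nat.card_eq_fintype_card, Fintype.card_subtype]

theorem prod_blockSize (hπ : HasBlockCounts k π) {M : Type*} [CommMonoid M] (f : ℕ → M) :
    ∏ q : Quotient π, f (blockSize q) = ∏ r ∈ Finset.Icc 1 n, f r ^ k r := by
  rw [← Finset.prod_fiberwise_of_maps_to fun q _ => blockSize_mem_Icc q]
  refine Finset.prod_congr rfl fun r hr => ?_
  rw [← hπ.card_filter hr]
  exact Finset.prod_eq_pow_card fun q hq => by rw [(Finset.mem_filter.1 hq).2]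

theorem card_quotient (hπ : HasBlockCounts k π) :
    Fintype.card (Quotient π) = ∑ r ∈ Finset.Icc 1 n, k r :=
  (Finset.card_eq_sum_card_fiberwise fun q _ => blockSize_mem_Icc q).trans
    (Finset.sum_congr rfl fun _ hr => hπ.card_filter hr)

theorem ewensPitmanEPPF_blockSize (hπ : HasBlockCounts k π) (α θ : ℝ) :
    ewensPitmanEPPF α θ (blockSize (π := π)) =
      (∏ i ∈ Finset.range (∑ r ∈ Finset.Icc 1 n, k r), (θ + i * α)) /
        (ascPochhammer ℝ n).eval θ *
      ∏ r ∈ Finset.Icc 1 n, ((ascPochhammer ℝ (r - 1)).eval (1 - α)) ^ k r := by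
  rw [ewensPitmanEPPF, Nat.card_eq_fintype_card, hπ.card_quotient, sum_blockSize, Nat.card_fin,
    hπ.prod_blockSize fun r => (ascPochhammer ℝ (r - 1)).eval (1 - α)]

end HasBlockCounts

theorem card_mul_eq_ewensPitmanProb {n : ℕ} {k : ℕ → ℕ}
    (hk : ∑ r ∈ Finset.Icc 1 n, r * k r = n) (α θ : ℝ) :
    Nat.card {π : Setoid (Fin n) // HasBlockCounts k π} *
      ((∏ i ∈ Finset.range (∑ r ∈ Finset.Icc 1 n, k r), (θ + i * α)) /
        (ascPochhammer ℝ n).eval θ *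
      ∏ r ∈ Finset.Icc 1 n, ((ascPochhammer ℝ (r - 1)).eval (1 - α)) ^ k r) =
    ewensPitmanProb α θ n k := by
  have card_mul : (Nat.card {π : Setoid (Fin n) // HasBlockCounts k π} : ℝ) *
      ∏ r ∈ Finset.Icc 1 n, ((r.factorial : ℝ) ^ k r * (k r).factorial) = n.factorial := by
    exact_mod_cast card_hasBlockCounts_mul k hk
  have prod_ne_zero : ∏ r ∈ Finset.Icc 1 n, ((r.factorial : ℝ) ^ k r * (k r).factorial) ≠ 0 :=
    Finset.prod_ne_zero_iff.2 fun r _ => by positivity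
  rw [ewensPitmanProb, Finset.prod_div_distrib, ← card_mul, mul_div_assoc', mul_right_comm,
    eq_div_iff prod_ne_zero]
  ring

theorem measureReal_blockCount_eq {Ω : Type*} {mΩ : MeasurableSpace Ω} {μ : Measure Ω}
    {X : Ω → Setoid ℕ} (hX : Measurable X) {α θ : ℝ} (hα0 : 0 ≤ α) (hα1 : α < 1) (hθ : 0 < θ)
    {n : ℕ} (h : ∀ (π : Setoid (Fin n)) [Fintype (Quotient π)],
      μ {ω | restrictFin n (X ω) = π} =
        ENNReal.ofReal (ewensPitmanEPPF α θ (blockSize (π := π))))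
    {k : ℕ → ℕ} (hk : ∑ r ∈ Finset.Icc 1 n, r * k r = n) :
    μ.real {ω | ∀ r ∈ Finset.Icc 1 n, blockCount (X ω) n r = k r} = ewensPitmanProb α θ n k := by
  classical
  have := finite_setoid (Fin n)
  have := Fintype.ofFinite (Setoid (Fin n))
  have eq_biUnion : {ω | ∀ r ∈ Finset.Icc 1 n, blockCount (X ω) n r = k r} =
      ⋃ π ∈ Finset.univ.filter (HasBlockCounts (n := n) k), {ω | restrictFin n (X ω) = π} := by
    ext ω
    rw [Set.mem_ofPred_eq, ← hasBlockCounts_restrictFin_iff]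
    simp
  have real_eq : ∀ π ∈ Finset.univ.filter (HasBlockCounts (n := n) k),
      μ.real {ω | restrictFin n (X ω) = π} =
      (∏ i ∈ Finset.range (∑ r ∈ Finset.Icc 1 n, k r), (θ + i * α)) /
        (ascPochhammer ℝ n).eval θ *
      ∏ r ∈ Finset.Icc 1 n, ((ascPochhammer ℝ (r - 1)).eval (1 - α)) ^ k r := fun π hπ => by
    rw [measureReal_def, h π, ENNReal.toReal_ofReal (ewensPitmanEPPF_nonneg hα0 hα1 hθ _),
      (Finset.mem_filter.1 hπ).2.ewensPitmanEPPF_blockSize]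
  have disjoint_restrictFin : Pairwise (Function.onFun Disjoint fun π =>
      {ω | restrictFin n (X ω) = π}) := fun π π' hππ' =>
    Set.disjoint_left.2 fun ω hω hω' => hππ' (hω.symm.trans hω')
  rw [eq_biUnion, measureReal_biUnion_finset (fun π _ π' _ hππ' => disjoint_restrictFin hππ')
      (fun π _ => hX (measurableSet_restrictFin_eq π))
      fun π _ => by rw [h π]; exact ENNReal.ofReal_ne_top,
    Finset.sum_congr rfl real_eq, Finset.sum_const, nsmul_eq_mul,
    ← card_mul_eq_ewensPitmanProb hk, Nat.card_eq_fintype_card, Fintype.card_subtype]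

end SamplingFormula

section EwensPitmanPartition

variable {Ω : Type*} {mΩ : MeasurableSpace Ω} {μ : Measure Ω} {α : ℝ}

theorem IsPoissonDirichletPaintbox.measurable {θ : ℝ} {P : ℕ → Ω → ℝ}
    (hP : IsPoissonDirichletPaintbox μ α θ P) (j : ℕ) : Measurable (P j) := by
  obtain ⟨W, hWmeas, -, -, hPW⟩ := hP
  rw [funext (hPW j)]
  fun_prop

variable [IsProbabilityMeasure μ]

theorem IsSplittingScheme.measure_restrictFin {ι : Type*} [Fintype ι] {τ : List ι → ℝ}
    {D : List ι → Ω → Option ι → ℝ} (h : IsSplittingScheme μ α τ D) (hα0 : 0 ≤ α) (hα1 : α < 1)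
    {C : ℕ → Ω → List ι} (hC : IsPaintboxSample μ (fun w ω => solidSize (fun v => D v ω) w) C)
    {n : ℕ} (π : Setoid (Fin n)) [Fintype (Quotient π)] :
    μ {ω | restrictFin n (colorPartition C ω) = π} =
      ENNReal.ofReal (ewensPitmanEPPF α (τ []) (blockSize (π := π))) := by
  rw [measure_restrictFin_colorPartition (fun w => measurable_solidSize (fun u k =>
    measurable_pi_iff.1 (h.measurable u) k) w) hC, ← h.subtreeEPPF_eq hα0 hα1 _
    blockSize_ne_zero]
  exact lintegral_congr fun ω => congrArg (paintboxEPPF · _)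
    (funext fun w => (subtreeSolid_root _ w).symm)

theorem IsPoissonDirichletPaintbox.measure_restrictFin {θ : ℝ} {P : ℕ → Ω → ℝ}
    (hP : IsPoissonDirichletPaintbox μ α θ P) (hα0 : 0 ≤ α) (hα1 : α < 1) (hθ : 0 < θ)
    {C : ℕ → Ω → ℕ} (hC : IsPaintboxSample μ P C) {n : ℕ} (π : Setoid (Fin n))
    [Fintype (Quotient π)] :
    μ {ω | restrictFin n (colorPartition C ω) = π} =
      ENNReal.ofReal (ewensPitmanEPPF α θ (blockSize (π := π))) := by
  rw [measure_restrictFin_colorPartition hP.measurable hC]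
  obtain ⟨W, hWmeas, hWindep, hWlaw, hPW⟩ := hP
  have stick := (isSplittingScheme_stickSplitting hα0 hα1 hθ hWmeas hWindep hWlaw).subtreeEPPF_eq
    hα0 hα1 (blockSize (π := π)) blockSize_ne_zero []
  simp only [List.length_nil, Nat.cast_zero, zero_mul, add_zero] at stick
  rw [← stick]
  refine lintegral_congr fun ω => ?_
  rw [← paintboxEPPF_comp_of_support ⟨List.length, length_injective_of_unit⟩ _ _ blockSize_ne_zero
    fun j _ => ⟨List.replicate j (), List.length_replicate⟩]
  refine congrArg (paintboxEPPF · _) (funext fun w => ?_)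
  simp only [subtreeSolid_root, solidSize_stickSplitting, hPW, Function.Embedding.coeFn_mk]

theorem identDistrib_colorPartition {Ω' J J' : Type*} {mΩ' : MeasurableSpace Ω'} {ν : Measure Ω'}
    [IsProbabilityMeasure ν] [Countable J] [Countable J'] {C : ℕ → Ω → J} {C' : ℕ → Ω' → J'}
    (hC : ∀ n j, MeasurableSet {ω | C n ω = j}) (hC' : ∀ n j, MeasurableSet {ω | C' n ω = j})
    (h : ∀ n (π : Setoid (Fin n)), μ {ω | restrictFin n (colorPartition C ω) = π} =
      ν {ω | restrictFin n (colorPartition C' ω) = π}) :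
    IdentDistrib (colorPartition C) (colorPartition C') μ ν := by
  have measurable := measurable_colorPartition hC
  have measurable' := measurable_colorPartition hC'
  have := Measure.isProbabilityMeasure_map (μ := μ) measurable.aemeasurable
  have := Measure.isProbabilityMeasure_map (μ := ν) measurable'.aemeasurable
  refine ⟨measurable.aemeasurable, measurable'.aemeasurable, ext_of_restrictFin fun n π => ?_⟩
  rw [Measure.map_apply measurable (measurableSet_restrictFin_eq π),
    Measure.map_apply measurable' (measurableSet_restrictFin_eq π)]
  exact h n π

end EwensPitmanPartition

theorem proposition8_general {ι : Type*} [Fintype ι] {α : ℝ} (hα0 : 0 ≤ α) (hα1 : α < 1)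
    {τ : List ι → ℝ} (hτ0 : ∀ w, 0 < τ w) (hτ : ∀ w, ∑ i, τ (i :: w) = τ w + α)
    {Ω : Type*} [MeasurableSpace Ω] (μ : Measure Ω) [IsProbabilityMeasure μ]
    (D : List ι → Ω → Option ι → ℝ) (hDmeas : ∀ w, Measurable (D w))
    (hDlaw : ∀ w, μ.map (D w) = dirichletMeasure (splitParam α fun i => τ (i :: w)))
    (hDindep : iIndepFun D μ) :
    (∀ᵐ ω ∂μ, (∀ w, 0 ≤ solidSize (fun v => D v ω) w) ∧
      HasSum (solidSize fun v => D v ω) 1) ∧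
    ∀ C : ℕ → Ω → List ι,
      IsPaintboxSample μ (fun w ω => solidSize (fun v => D v ω) w) C →
      (∀ {Ω' : Type*} [MeasurableSpace Ω'] (ν : Measure Ω') [IsProbabilityMeasure ν]
        (P : ℕ → Ω' → ℝ) (C' : ℕ → Ω' → ℕ),
        IsPoissonDirichletPaintbox ν α (τ []) P → IsPaintboxSample ν P C' →
        IdentDistrib (colorPartition C) (colorPartition C') μ ν) ∧
      ∀ (n : ℕ) (k : ℕ → ℕ), ∑ r ∈ Finset.Icc 1 n, r * k r = n →
        μ.real {ω | ∀ r ∈ Finset.Icc 1 n, blockCount (colorPartition C ω) n r = k r} =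
          ewensPitmanProb α (τ []) n k := by
  have scheme := isSplittingScheme_of_dirichlet hα1 hτ0 hτ hDmeas hDlaw hDindep
  refine ⟨scheme.ae_hasSum_solidSize hα0 hα1, fun C hC => ⟨?_, fun n k hk => ?_⟩⟩
  · intro Ω' _ ν _ P C' hP hC'
    refine identDistrib_colorPartition hC.1 hC'.1 fun n π => ?_
    have := Fintype.ofFinite (Quotient π)
    exact (scheme.measure_restrictFin hα0 hα1 hC π).trans
      (hP.measure_restrictFin hα0 hα1 (hτ0 []) hC' π).symm
  · exact measureReal_blockCount_eq (measurable_colorPartition hC.1) hα0 hα1 (hτ0 [])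
      (fun π _ => scheme.measure_restrictFin hα0 hα1 hC π) hk

theorem splittingParam_eq_splitParam (d : ℕ) (α : ℝ) :
    splittingParam d α = splitParam α fun _ => α / d := by
  funext k
  cases k <;> rfl

theorem sum_div_eq_div_add {d : ℕ} (hd : d ≠ 0) (α : ℝ) :
    ∑ _i : Fin (d + 1), α / d = α / d + α := by
  rw [Finset.sum_const, Finset.card_univ, Fintype.card_fin, nsmul_eq_mul, Nat.cast_add_one,
    add_one_mul, mul_div_cancel₀ _ (Nat.cast_ne_zero.2 hd), add_comm]

theorem proposition8 {d : ℕ} (hd : 1 ≤ d) {α : ℝ} (hα0 : 0 < α) (hα1 : α < 1)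
    {Ω : Type*} [MeasurableSpace Ω] (μ : Measure Ω) [IsProbabilityMeasure μ]
    (D : List (Fin (d + 1)) → Ω → Option (Fin (d + 1)) → ℝ)
    (hDmeas : ∀ w, Measurable (D w))
    (hDlaw : ∀ w, μ.map (D w) = dirichletMeasure (splittingParam d α))
    (hDindep : iIndepFun D μ) :
    -- the sizes of the solids form a paintbox
    (∀ᵐ ω ∂μ, (∀ w, 0 ≤ solidSize (fun v => D v ω) w) ∧
      HasSum (solidSize fun v => D v ω) 1) ∧
    -- the partition obtained by painting the balls
    ∀ C : ℕ → Ω → List (Fin (d + 1)),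
      IsPaintboxSample μ (fun w ω => solidSize (fun v => D v ω) w) C →
      -- has the law of the partition induced by the Poisson–Dirichlet `(α, α/d)` paintbox
      (∀ {Ω' : Type*} [MeasurableSpace Ω'] (ν : Measure Ω') [IsProbabilityMeasure ν]
        (P : ℕ → Ω' → ℝ) (C' : ℕ → Ω' → ℕ),
        IsPoissonDirichletPaintbox ν α (α / d) P → IsPaintboxSample ν P C' →
        IdentDistrib (colorPartition C) (colorPartition C') μ ν) ∧
      -- and follows the Ewens–Pitman `(α, α/d)` sampling formula
      ∀ (n : ℕ) (k : ℕ → ℕ), ∑ r ∈ Finset.Icc 1 n, r * k r = n →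
        μ.real {ω | ∀ r ∈ Finset.Icc 1 n, blockCount (colorPartition C ω) n r = k r} =
          ewensPitmanProb α (α / d) n k := by
  have hθ : 0 < α / d := div_pos hα0 (Nat.cast_pos.2 hd)
  exact proposition8_general hα0.le hα1 (fun _ => hθ)
    (fun _ => sum_div_eq_div_add (Nat.one_le_iff_ne_zero.1 hd) α) μ D hDmeas
    (splittingParam_eq_splitParam d α ▸ hDlaw) hDindep
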